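/- Definitions. A graph is a pair $\langle G,E\rangle$ with $G$ a set and $E\subseteq G\times G$; a homomorphism $\langle G,E\rangle\to\langle G',E'\rangle$ is a function $h:G\to G'$ such that $\langle v,w\rangle\in E$ implies $\langle h(v),h(w)\rangle\in E'$. *Semi-Weak Vopěnka's Principle* (SWVP) says that no sequence of graphs $\langle G_\alpha:\alpha\in\mathrm{Ord}\rangle$ has both of the following properties: whenever $\alpha\le\alpha'$ there is a homomorphism $G_{\alpha'}\to G_\alpha$, and whenever $\alpha<\alpha'$ there is no homomorphism $G_\alpha\to G_{\alpha'}$. *Vopěnka's Principle* (VP) says that for every proper class of graphs there is a non-identity homomorphism among the graphs in that class. Both are regarded as sentences in the language $\{\in\}$ of second-order set theory, whose objects are classes, and whose sets are the classes that are elements of some class; a structure $\langle V_{\kappa+1},\in\rangle$ thus has the elements of $V_\kappa$ as its sets and the elements of $V_{\kappa+1}$ as its classes. For a set $X$ let $\mathcal P_\kappa(X)=\{A\subseteq X:|A|<\kappa\}$. An uncountable cardinal $\kappa$ is *supercompact* if for every set $X$ there is a $\kappa$-complete ultrafilter $U$ on $\mathcal P_\kappa(X)$ that is fine ($\{A\in\mathcal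 P_\kappa(X):x\in A\}\in U$ for every $x\in X$) and normal (every function $f$ whose domain is in $U$ and that satisfies $f(A)\in A$ for all $A$ in its domain is constant on a set in $U$). Theorem (ZFC). Let $\kappa$ be the least supercompact cardinal. Then 1. $\langle V_{\kappa+1},\in\rangle$ satisfies SWVP; 2. $\langle V_{\kappa+1},\in\rangle$ satisfies the sentence "there is no supercompact cardinal" (that is, no uncountable cardinal $\mu\in V_\kappa$ satisfies in this structure the above definition, with $X$ and $U$ ranging over sets); 3. consequently SWVP does not imply VP: VP is not a logical consequence of the theory GB + AC + SWVP, where GB + AC is Gödel–Bernays set theory with the Axiom of Choice for sets. -/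

import Mathlib

open FirstOrder FirstOrder.Language

universe u

namespace SetTheoryModel

/-! ## Supercompact cardinals in the ambient universe of sets -/

/-- `𝒫_κ(X)`: the subsets of `X` of cardinality less than `κ`. -/
def SmallSubset (κ : Cardinal.{u}) (X : Type u) : Type u :=
  {A : Set X // Cardinal.mk A < κ}

/-- Fineness of an ultrafilter on `𝒫_κ(X)`. -/
def IsFine {κ : Cardinal.{u}} {X : Type u} (U : Ultrafilter (SmallSubset κ X)) : Prop :=
  ∀ x : X, {A : SmallSubset κ X | x ∈ A.1} ∈ U

/-- Normality of an ultrafilter on `𝒫_κ(X)`: every choice function defined on a set in the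
ultrafilter is constant on a set in the ultrafilter. -/
def IsNormal {κ : Cardinal.{u}} {X : Type u} (U : Ultrafilter (SmallSubset κ X)) : Prop :=
  ∀ S ∈ U, ∀ f : {A : SmallSubset κ X // A ∈ S} → X, (∀ A, f A ∈ A.1.1) →
    ∃ x : X, {A : SmallSubset κ X | ∃ hA : A ∈ S, f ⟨A, hA⟩ = x} ∈ U

/-- `κ` is `X`-supercompact: there is a normal fine `κ`-complete ultrafilter on `𝒫_κ(X)`. -/
def IsSupercompactFor (κ : Cardinal.{u}) (X : Type u) : Prop :=
  ∃ U : Ultrafilter (SmallSubset κ X),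
    CardinalInterFilter (U : Filter (SmallSubset κ X)) κ ∧ IsFine U ∧ IsNormal U

/-- An uncountable cardinal is supercompact if it is `X`-supercompact for every set `X`. -/
def IsSupercompact (κ : Cardinal.{u}) : Prop :=
  Cardinal.aleph0 < κ ∧ ∀ X : Type u, IsSupercompactFor κ X

/-! ## The language of set theory and the structures `⟨V_o, ∈⟩` -/

/-- The relation symbols of the language of set theory. -/
inductive MemRel : ℕ → Type
  | mem : MemRel 2

/-- The first-order language with a single binary relation symbol. -/
def setLang : FirstOrder.Language.{0, 0} := ⟨fun _ => Empty, MemRel⟩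

/-- The underlying set of the level `V_o` of the cumulative hierarchy. -/
def Level (o : Ordinal.{u}) : Type (u + 1) := {x : ZFSet.{u} // x ∈ ZFSet.vonNeumann o}

/-- The structure `⟨V_o, ∈⟩`. -/
instance levelStructure (o : Ordinal.{u}) : setLang.Structure (Level o) where
  funMap := fun f _ => nomatch f
  RelMap := fun r xs => match r, xs with
    | .mem, xs => (xs 0).1 ∈ (xs 1).1

/-! ## Formulas

A formula in `Fm n` has its free variables among `n` variables, named by the elements of `Fin n`.
A quantifier binds the last variable of the larger context `Fin (n + 1)`; the old variables are
coerced into the larger context by `Fin.castSucc`. The models of interest are models of class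
theory: the objects are classes, and the sets are the classes that are elements of some class. -/

/-- Formulas of the language of set theory in `n` variables. -/
abbrev Fm (n : ℕ) : Type := setLang.BoundedFormula Empty n

instance varCoe (n : ℕ) : Coe (Fin n) (Fin (n + 1)) := ⟨Fin.castSucc⟩

variable {n : ℕ}

/-- `x ∈ y` -/
def mem (x y : Fin n) : Fm n :=
  Relations.boundedFormula₂ (L := setLang) MemRel.mem (Term.var (Sum.inr x)) (Term.var (Sum.inr y))

/-- `x = y` -/
def eql (x y : Fin n) : Fm n :=
  Term.bdEqual (Term.var (Sum.inr x)) (Term.var (Sum.inr y))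

/-- Conjunction. -/
def conj (φ ψ : Fm n) : Fm n := φ ⊓ ψ

/-- Disjunction. -/
def disj (φ ψ : Fm n) : Fm n := φ ⊔ ψ

-- Infix notation for atomic formulas, conjunction and disjunction.
scoped infix:88 " ∈ₛ " => mem
scoped infix:88 " =ₛ " => eql
scoped infixr:66 " ⋏ " => conj
scoped infixr:65 " ⋎ " => disj

/-- `∀ x, φ x`, where `x` ranges over all objects (classes). -/
def all (φ : Fin (n + 1) → Fm (n + 1)) : Fm n := (φ (Fin.last n)).all

/-- `∃ x, φ x`, where `x` ranges over all objects (classes). -/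
def ex (φ : Fin (n + 1) → Fm (n + 1)) : Fm n := (φ (Fin.last n)).ex

/-- `∀ x ∈ a, φ x` -/
def allIn (a : Fin n) (φ : Fin (n + 1) → Fm (n + 1)) : Fm n := all fun x => x ∈ₛ a ⟹ φ x

/-- `∃ x ∈ a, φ x` -/
def exIn (a : Fin n) (φ : Fin (n + 1) → Fm (n + 1)) : Fm n := ex fun x => x ∈ₛ a ⋏ φ x

/-- `x` is a set, i.e. an element of some class. -/
def isSet (x : Fin n) : Fm n := ex fun y => x ∈ₛ y

/-- `∀ x, φ x`, where `x` ranges over sets. -/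
def allSet (φ : Fin (n + 1) → Fm (n + 1)) : Fm n := all fun x => isSet x ⟹ φ x

/-- `∃ x, φ x`, where `x` ranges over sets. -/
def exSet (φ : Fin (n + 1) → Fm (n + 1)) : Fm n := ex fun x => isSet x ⋏ φ x

/-- `x ⊆ y` -/
def sub (x y : Fin n) : Fm n := all fun z => z ∈ₛ x ⟹ z ∈ₛ y

/-- `x` is empty. -/
def isEmpty (x : Fin n) : Fm n := all fun z => ∼(z ∈ₛ x)

/-- `p = {x, y}` -/
def isUPair (p x y : Fin n) : Fm n := all fun z => z ∈ₛ p ⇔ (z =ₛ x ⋎ z =ₛ y)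

/-- `p = ⟨x, y⟩ = {{x}, {x, y}}` -/
def isPair (p x y : Fin n) : Fm n :=
  ex fun s => ex fun t => isUPair s x x ⋏ isUPair t x y ⋏ isUPair p s t

/-- `⟨x, y⟩ ∈ r` -/
def pairMem (x y r : Fin n) : Fm n := exIn r fun p => isPair p x y

/-- `f` is a function from `a` to `b`. -/
def isFun (f a b : Fin n) : Fm n :=
  (allIn f fun p => exIn a fun x => exIn b fun y => isPair p x y) ⋏
  (allIn a fun x => exIn b fun y => pairMem x y f ⋏ all fun z => pairMem x z f ⟹ z =ₛ y)

/-- `f` is an injective function from `a` to `b`. -/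
def isInj (f a b : Fin n) : Fm n :=
  isFun f a b ⋏ all fun x => all fun y => all fun z => (pairMem x z f ⋏ pairMem y z f) ⟹ x =ₛ y

/-- `x` is transitive. -/
def isTrans (x : Fin n) : Fm n := allIn x fun y => sub y x

/-- The set `x` is an ordinal: a transitive set of transitive sets. -/
def isOrd (x : Fin n) : Fm n := isSet x ⋏ isTrans x ⋏ allIn x fun y => isTrans y

/-! ## Graphs, Semi-Weak Vopěnka's Principle and Vopěnka's Principle -/

/-- `g` is the pair `⟨v, e⟩`, and `e` is a binary relation on `v`. -/
def isGraphWith (g v e : Fin n) : Fm n :=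
  isPair g v e ⋏ allIn e fun p => exIn v fun x => exIn v fun y => isPair p x y

/-- `g` is a graph. -/
def isGraph (g : Fin n) : Fm n := ex fun v => ex fun e => isGraphWith g v e

/-- `h` is a homomorphism from the graph `g` to the graph `g'`. -/
def isHom (h g g' : Fin n) : Fm n :=
  ex fun v => ex fun e => ex fun v' => ex fun e' =>
    isGraphWith g v e ⋏ isGraphWith g' v' e' ⋏ isFun h v v' ⋏
    all fun x => all fun y => pairMem x y e ⟹
      ex fun x' => ex fun y' => pairMem x x' h ⋏ pairMem y y' h ⋏ pairMem x' y' e'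

/-- There is a homomorphism from `g` to `g'`. -/
def existsHom (g g' : Fin n) : Fm n := ex fun h => isHom h g g'

/-- The class `s` is a sequence of graphs indexed by all ordinals. -/
def isOrdSeq (s : Fin n) : Fm n :=
  (allIn s fun p => ex fun a => ex fun g => isOrd a ⋏ isGraph g ⋏ isPair p a g) ⋏
  all fun a => isOrd a ⟹ ex fun g => pairMem a g s ⋏ all fun g' => pairMem a g' s ⟹ g' =ₛ g

/-- Semi-Weak Vopěnka's Principle: no sequence of graphs `⟨G_a : a ∈ Ord⟩` has both a homomorphism
`G_b → G_a` whenever `a ≤ b` and no homomorphism `G_a → G_b` whenever `a < b`. -/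
def SWVP : setLang.Sentence :=
  ∼(ex (n := 0) fun s => isOrdSeq s ⋏
    (all fun a => all fun b => all fun g => all fun g' =>
      (pairMem a g s ⋏ pairMem b g' s ⋏ (a ∈ₛ b ⋎ a =ₛ b)) ⟹ existsHom g' g) ⋏
    (all fun a => all fun b => all fun g => all fun g' =>
      (pairMem a g s ⋏ pairMem b g' s ⋏ a ∈ₛ b) ⟹ ∼(existsHom g g')))

/-- Vopěnka's Principle: for every proper class of graphs there is a non-identity homomorphism
among the graphs in that class. -/
def VP : setLang.Sentence :=
  all (n := 0) fun c => (∼(isSet c) ⋏ allIn c fun g => isGraph g) ⟹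
    exIn c fun g => exIn c fun g' => ex fun h =>
      isHom h g g' ⋏ ∼(g =ₛ g' ⋏ all fun x => all fun y => pairMem x y h ⟹ x =ₛ y)

/-! ## Supercompact cardinals inside a structure -/

/-- `|a| < k` (for a cardinal `k`): some function injects `a` into an element of `k`. -/
def cardLT (a k : Fin n) : Fm n := exIn k fun b => ex fun f => isInj f a b

/-- `k` is a cardinal: an ordinal that does not inject into any smaller ordinal. -/
def isCard (k : Fin n) : Fm n := isOrd k ⋏ ∼(cardLT k k)

/-- `k` is an uncountable cardinal: a cardinal that has a nonzero limit ordinal as an element. -/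
def isUncountableCard (k : Fin n) : Fm n :=
  isCard k ⋏ exIn k fun w => ∼(isEmpty w) ⋏ allIn w fun x => exIn w fun y => x ∈ₛ y

/-- `p` is `𝒫_k(x)`. -/
def isSmallSubsets (p k x : Fin n) : Fm n := all fun a => a ∈ₛ p ⇔ (sub a x ⋏ cardLT a k)

/-- `u` is an ultrafilter on `p`. -/
def isUltrafilter (u p : Fin n) : Fm n :=
  (allIn u fun s => sub s p) ⋏
  p ∈ₛ u ⋏
  (allIn u fun s => ∼(isEmpty s)) ⋏
  (allIn u fun s => all fun t => (sub s t ⋏ sub t p) ⟹ t ∈ₛ u) ⋏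
  (allIn u fun s => allIn u fun t => exIn u fun r => all fun z => z ∈ₛ r ⇔ (z ∈ₛ s ⋏ z ∈ₛ t)) ⋏
  (all fun s => sub s p ⟹
    (s ∈ₛ u ⋎ exIn u fun t => all fun z => z ∈ₛ t ⇔ (z ∈ₛ p ⋏ ∼(z ∈ₛ s))))

/-- The ultrafilter `u` on `p` is `k`-complete. -/
def isComplete (u p k : Fin n) : Fm n :=
  allSet fun c => (sub c u ⋏ cardLT c k) ⟹
    exIn u fun s => all fun a => a ∈ₛ s ⇔ (a ∈ₛ p ⋏ allIn c fun t => a ∈ₛ t)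

/-- The ultrafilter `u` on `p = 𝒫_k(x)` is fine. -/
def isFine (u p x : Fin n) : Fm n :=
  allIn x fun y => exIn u fun s => all fun a => a ∈ₛ s ⇔ (a ∈ₛ p ⋏ y ∈ₛ a)

/-- The ultrafilter `u` on `𝒫_k(x)` is normal. -/
def isNormal (u x : Fin n) : Fm n :=
  allIn u fun s => all fun f =>
    (isFun f s x ⋏ all fun a => all fun y => pairMem a y f ⟹ y ∈ₛ a) ⟹
      exIn x fun y => exIn u fun t => sub t s ⋏ allIn t fun a => pairMem a y f

/-- `k` is supercompact: an uncountable cardinal such that for every set `x` there is a normal fine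
`k`-complete ultrafilter on `𝒫_k(x)`. -/
def isSupercompact (k : Fin n) : Fm n :=
  isUncountableCard k ⋏ allSet fun x => exSet fun p => exSet fun u =>
    isSmallSubsets p k x ⋏ isUltrafilter u p ⋏ isComplete u p k ⋏ isFine u p x ⋏ isNormal u x

/-- "There is a supercompact cardinal." -/
def existsSupercompact : setLang.Sentence := ex (n := 0) fun k => isSupercompact k

/-! ## Gödel–Bernays set theory with the Axiom of Choice for sets -/

/-- Classes with the same elements are equal. -/
def extensionality : setLang.Sentence :=
  all (n := 0) fun x => all fun y => (all fun z => z ∈ₛ x ⇔ z ∈ₛ y) ⟹ x =ₛ y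

/-- Every nonempty class has an element that is disjoint from it. -/
def foundation : setLang.Sentence :=
  all (n := 0) fun c => ∼(isEmpty c) ⟹ exIn c fun x => allIn x fun y => ∼(y ∈ₛ c)

/-- Any two sets have an unordered pair, which is a set. -/
def pairing : setLang.Sentence :=
  allSet (n := 0) fun x => allSet fun y => exSet fun p => isUPair p x y

/-- The union of a set is a set. -/
def union : setLang.Sentence :=
  allSet (n := 0) fun x => exSet fun s => all fun z => z ∈ₛ s ⇔ exIn x fun y => z ∈ₛ y

/-- The power set of a set is a set. -/
def powerset : setLang.Sentence :=
  allSet (n := 0) fun x => exSet fun s => all fun z => z ∈ₛ s ⇔ sub z x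

/-- There is a set that contains the empty set and is closed under `x ↦ x ∪ {x}`. -/
def infinity : setLang.Sentence :=
  exSet (n := 0) fun w => (exIn w fun x => isEmpty x) ⋏
    allIn w fun x => exIn w fun y => all fun z => z ∈ₛ y ⇔ (z ∈ₛ x ⋎ z =ₛ x)

/-- The image of a set under a class function is a set. -/
def replacement : setLang.Sentence :=
  all (n := 0) fun f =>
    (all fun x => all fun y => all fun z => (pairMem x y f ⋏ pairMem x z f) ⟹ y =ₛ z) ⟹
      allSet fun a => exSet fun b => all fun y => y ∈ₛ b ⇔ exIn a fun x => pairMem x y f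

/-- Every set of nonempty sets has a choice function, which is a set. -/
def choice : setLang.Sentence :=
  allSet (n := 0) fun a => (allIn a fun x => ∼(isEmpty x)) ⟹
    exSet fun f => ex fun b => isFun f a b ⋏ all fun x => all fun y => pairMem x y f ⟹ y ∈ₛ x

/-- The relativization of a formula to sets: all its quantifiers are restricted to sets. -/
def relativize : {n : ℕ} → Fm n → Fm n
  | _, .falsum => .falsum
  | _, .equal s t => .equal s t
  | _, .rel r ts => .rel r ts
  | _, .imp φ ψ => .imp (relativize φ) (relativize ψ)
  | n, .all φ => .all (isSet (Fin.last n) ⟹ relativize φ)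

/-- Class comprehension for a formula `φ` without quantification over classes: for all classes
`p₀, …, pₙ₋₁` there is a class `c` whose elements are the sets `x` with `φ(p₀, …, pₙ₋₁, x)`.
The variable `x` has index `n` in `φ` and index `n + 1` in the axiom, where `c` has index `n`. -/
def comprehension (φ : Fm (n + 1)) : setLang.Sentence :=
  BoundedFormula.alls (ex (n := n) fun c => allSet fun x =>
    x ∈ₛ c ⇔ BoundedFormula.liftAt 1 n (relativize φ))

/-- Gödel–Bernays set theory with the Axiom of Choice for sets. -/
def GBAC : setLang.Theory :=
  {extensionality, foundation, pairing, union, powerset, infinity, replacement, choice} ∪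
    {σ | ∃ (n : ℕ) (φ : Fm (n + 1)), σ = comprehension φ}

end SetTheoryModel

/-! SWVP at a supercompact `κ`. Given graphs `G a` of size below `κ` with homomorphisms backwards,
take a normal fine `κ`-complete ultrafilter on the small subsets of the disjoint union of `∏ G a`
and `κ`. Almost every `A` behaves like an elementary submodel: threads in `A` that are related at
every index in `A` are related everywhere, and every choice of vertices at the indices in `A`
extends to a thread in `A`. For an index `d` above all indices in such an `A`, the maps from `G d`
to the `G a` with `a` in `A` assign to each vertex of `G d` a thread in `A`. Evaluation of these
threads at an index above `d` is a forward homomorphism (`IsSupercompact.semiWeakVopenka`). Since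
`κ` is inaccessible, this transfers to the level (`level_models_SWVP`).

No supercompact in the level. The level at `κ` contains all subsets of its elements, so a cardinal
`μ` that is supercompact there is truly `X`-supercompact for every `X` of size below `κ`.
Integrating the resulting ultrafilters against an ultrafilter for `κ` makes `μ` supercompact
(`IsSupercompact.of_forall_lt`), against the minimality of `κ`.

Independence of VP. The model is the level above the least inaccessible `c` at which SWVP holds;
this `c` is at most `κ`. For each `δ` below `c` there is a structure made of the points up to `δ`
and the self-maps of initial segments with length at most `δ`. A homomorphism between two of these
structures that moves a point has a least moved point `ε`, a critical point. Every `ε` carries a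
certificate, expressed by relations, against this: it is the supremum of a shorter sequence; or it
is zero or a limit whose nonzero predecessors are all successors; or it injects into the functions
on a smaller ordinal; or it indexes a counterexample to SWVP. If the first three certificates are
missing, then `ε` is an inaccessible cardinal below `c`, and minimality of `c` supplies the fourth.
Hence all points are fixed and the structures are rigid (`rigid_of_witnesses`). Coded as graphs they
form a proper class with no non-identity homomorphism (`exists_rigid_family`,
`level_not_models_VP`). -/

open Cardinal Filter

namespace SetTheoryModel

/-! ## Consequences of supercompactness -/

section Ultrafilters

variable {κ : Cardinal.{u}} {X : Type u} {U : Ultrafilter (SmallSubset κ X)}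

/-- Normality as a choice principle: a property of elements of `A` that can be satisfied for almost
all `A` can be satisfied by the same element for almost all `A`. -/
theorem IsNormal.exists_eventually (hU : IsNormal U) {P : SmallSubset κ X → X → Prop}
    (h : ∀ᶠ A in U, ∃ x ∈ A.1, P A x) : ∃ x, ∀ᶠ A in U, P A x := by
  have h' : ∀ A : {A : SmallSubset κ X // A ∈ {A | ∃ x ∈ A.1, P A x}}, ∃ x ∈ A.1.1, P A.1 x :=
    fun A => A.2
  choose f hf hP using h'
  obtain ⟨x, hx⟩ := hU _ h f hf
  refine ⟨x, mem_of_superset hx ?_⟩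
  rintro A ⟨hA, rfl⟩
  exact hP ⟨A, hA⟩

theorem eventually_mem_of_isFine (hU : IsFine U) (x : X) :
    ∀ᶠ A in (U : Filter (SmallSubset κ X)), x ∈ A.1 :=
  hU x

/-- Otherwise each of the fewer than `κ` values would be excluded almost everywhere, and by
completeness all would be excluded at once. -/
theorem eventually_exists_of_complete {α : Type u} {U : Ultrafilter α}
    (hU : CardinalInterFilter (U : Filter α) κ) {G : Type u} (hG : #G < κ) {P : α → G → Prop}
    (h : ∀ᶠ a in U, ∃ g, P a g) : ∃ g, ∀ᶠ a in U, P a g := by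
  by_contra! hne
  have h1 : ∀ g, ∀ᶠ a in (U : Filter α), ¬ P a g := hne
  have h2 := (eventually_cardinal_forall hG).2 h1
  obtain ⟨a, ⟨g, hg⟩, ha⟩ := (h.and h2).exists
  exact ha g hg

theorem exists_notMem_smallSubset (hX : κ ≤ #X) (A : SmallSubset κ X) : ∃ x, x ∉ A.1 := by
  by_contra! h
  have : A.1 = Set.univ := Set.eq_univ_of_forall h
  have h2 := A.2
  rw [this, mk_univ] at h2
  exact absurd hX (not_le.2 h2)

end Ultrafilters

/-- If the power set of some `Λ` smaller than `κ` had size at least `κ`, every small `A` would omit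
a subset `x A` of `Λ`. Completeness makes `x A` almost everywhere equal to one set `p`, decided
element by element, while fineness puts `p` into almost every `A`. -/
theorem IsSupercompact.isStrongLimit {κ : Cardinal.{u}} (h : IsSupercompact κ) :
    IsStrongLimit κ := by
  refine ⟨(aleph0_pos.trans h.1).ne', fun l hl => ?_⟩
  induction l using Cardinal.inductionOn with | _ Λ
  by_contra! hle
  obtain ⟨U, hU, hfine, -⟩ := h.2 (Set Λ)
  rw [← mk_set] at hle
  choose x hx using exists_notMem_smallSubset hle
  let p : Set Λ := {ξ | ∀ᶠ A in U, ξ ∈ x A}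
  have h1 : ∀ᶠ A in (U : Filter (SmallSubset κ (Set Λ))), ∀ ξ, (ξ ∈ x A ↔ ξ ∈ p) := by
    refine (eventually_cardinal_forall hl).2 fun ξ => ?_
    by_cases hξ : ξ ∈ p
    · filter_upwards [hξ] with A hA using by simp [hA, hξ]
    · have : ∀ᶠ A in (U : Filter (SmallSubset κ (Set Λ))), ¬ ξ ∈ x A :=
        Ultrafilter.eventually_not.2 hξ
      filter_upwards [this] with A hA using by simp [hA, hξ]
  obtain ⟨A, hA, hpA⟩ := (h1.and (eventually_mem_of_isFine hfine p)).exists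
  exact hx A (Set.ext hA ▸ hpA)

/-- If a set of fewer than `κ` points were cofinal in `κ`, then by fineness and completeness almost
every small set would contain the segments below all of these points, hence all of `κ`. -/
theorem IsSupercompact.isRegular {κ : Cardinal.{u}} (h : IsSupercompact κ) : Cardinal.IsRegular κ := by
  refine ⟨h.1.le, ?_⟩
  rw [← Ordinal.cof_toType, Order.le_cof_iff]
  intro S hS
  by_contra! hlt
  obtain ⟨U, hU, hfine, -⟩ := h.2 κ.ord.ToType
  have h1 : ∀ᶠ A in (U : Filter (SmallSubset κ κ.ord.ToType)), ∀ s : S, ∀ a : Set.Iic s.1,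
      a.1 ∈ A.1 := by
    refine (eventually_cardinal_forall hlt).2 fun s => ?_
    have hs : #(Set.Iic s.1) < κ := by
      rw [← Set.Iio_insert]
      exact mk_insert_le.trans_lt (add_lt_of_lt h.1.le (by simpa using Cardinal.mk_Iio_lt s.1)
        (one_lt_aleph0.trans h.1))
    exact (eventually_cardinal_forall hs).2 fun a => hfine a.1
  obtain ⟨A, hA⟩ := h1.exists
  obtain ⟨a, ha⟩ := exists_notMem_smallSubset (mk_ord_toType κ).ge A
  obtain ⟨s, hs, has⟩ := hS a
  exact ha (hA ⟨s, hs⟩ ⟨a, has⟩)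

theorem IsSupercompact.isInaccessible {κ : Cardinal.{u}} (h : IsSupercompact κ) :
    IsInaccessible κ :=
  isInaccessible_def.2 ⟨h.1, h.isRegular, h.isStrongLimit⟩

/-! ## Semi-Weak Vopěnka's Principle for a cardinal -/

/-- Semi-Weak Vopěnka's Principle for sequences of length `κ` of graphs of size less than `κ`. -/
def SemiWeakVopenka (κ : Cardinal.{u}) : Prop :=
  ∀ (G : κ.ord.ToType → Type u) (E : ∀ a, G a → G a → Prop), (∀ a, #(G a) < κ) →
    (∀ a b, a ≤ b → Nonempty (E b →r E a)) → ∃ a b, a < b ∧ Nonempty (E a →r E b)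

theorem exists_lt_of_card_lt {κ : Cardinal.{u}} (hκ : Cardinal.IsRegular κ) {S : Set κ.ord.ToType}
    (hS : #S < κ) : ∃ b, ∀ a ∈ S, a < b := by
  have : ¬ IsCofinal S := fun h => by
    have := Order.cof_le h
    rw [Ordinal.cof_toType, hκ.cof_ord] at this
    exact absurd hS this.not_gt
  simpa [IsCofinal] using this

theorem IsSupercompact.semiWeakVopenka {κ : Cardinal.{u}} (h : IsSupercompact κ) :
    SemiWeakVopenka κ := by
  intro G E hG hom
  obtain ⟨U, hU, hfine, hnormal⟩ := h.2 ((∀ a, G a) ⊕ κ.ord.ToType)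
  have hfine' := eventually_mem_of_isFine hfine
  -- Reflection of the edge relation. Normality, used twice, would turn failure for almost all `A`
  -- into a fixed pair `p`, `q` that is related at all indices in almost every `A` and unrelated at
  -- some `a`. Fineness at `a` refutes this.
  have h1 : ∀ᶠ A in (U : Filter (SmallSubset κ ((∀ a, G a) ⊕ κ.ord.ToType))),
      ∀ p q, Sum.inl p ∈ A.1 → Sum.inl q ∈ A.1 →
        (∀ a, Sum.inr a ∈ A.1 → E a (p a) (q a)) → ∀ a, E a (p a) (q a) := by
    by_contra hne
    have h2 := Ultrafilter.eventually_not.2 hne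
    obtain ⟨x, hx⟩ := hnormal.exists_eventually (P := fun A x => ∃ p, x = Sum.inl p ∧
        ∃ y ∈ A.1, ∃ q, y = Sum.inl q ∧ (∀ a, Sum.inr a ∈ A.1 → E a (p a) (q a)) ∧
          ∃ a, ¬ E a (p a) (q a)) (by
      filter_upwards [h2] with A hA
      push Not at hA
      obtain ⟨p, q, hp, hq, hpq, hE⟩ := hA
      exact ⟨_, hp, p, rfl, _, hq, q, rfl, hpq, hE⟩)
    obtain ⟨p, rfl, -⟩ := hx.exists.choose_spec
    obtain ⟨y, hy⟩ := hnormal.exists_eventually (P := fun A y => ∃ q, y = Sum.inl q ∧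
        (∀ a, Sum.inr a ∈ A.1 → E a (p a) (q a)) ∧ ∃ a, ¬ E a (p a) (q a)) (by
      filter_upwards [hx] with A hA
      obtain ⟨p', hp', y, hy, q, hq⟩ := hA
      cases hp'
      exact ⟨y, hy, q, hq⟩)
    obtain ⟨q, rfl, -, a, ha⟩ := hy.exists.choose_spec
    obtain ⟨A, ⟨q', hq', hA, -⟩, haA⟩ := (hy.and (hfine' (Sum.inr a))).exists
    cases hq'
    exact ha (hA a haA)
  -- Extension of partial threads. If `s A` were a counterexample for almost all `A`, then since
  -- each `G a` is small the values of `s A` at `a` would stabilize to a thread `p`. Almost every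
  -- `A` contains `p`, so `p` differs from `s A` at an index in `A`; normality makes this index
  -- constant, against stabilization.
  have h2 : ∀ᶠ A in (U : Filter (SmallSubset κ ((∀ a, G a) ⊕ κ.ord.ToType))),
      ∀ s : ∀ a : {a // Sum.inr a ∈ A.1}, G a, ∃ p, Sum.inl p ∈ A.1 ∧ ∀ a, p a.1 = s a := by
    by_contra hne
    have h3 := Ultrafilter.eventually_not.2 hne
    push Not at h3
    set S := {A : SmallSubset κ ((∀ a, G a) ⊕ κ.ord.ToType) |
      ∃ s : ∀ a : {a // Sum.inr a ∈ A.1}, G a, ∀ p, Sum.inl p ∈ A.1 → ∃ a, p a.1 ≠ s a} with hS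
    have hSU : ∀ᶠ A in (U : Filter (SmallSubset κ ((∀ a, G a) ⊕ κ.ord.ToType))), A ∈ S := h3
    have h4 : ∀ A, A ∈ S → ∃ s : ∀ a : {a // Sum.inr a ∈ A.1}, G a,
      ∀ p, Sum.inl p ∈ A.1 → ∃ a, p a.1 ≠ s a := fun A hA => hA
    choose s hs using h4
    have h5 : ∀ a, ∃ g : G a, ∀ᶠ A in (U : Filter (SmallSubset κ ((∀ a, G a) ⊕ κ.ord.ToType))),
        ∃ (hA : A ∈ S) (ha : Sum.inr a ∈ A.1), s A hA ⟨a, ha⟩ = g := by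
      intro a
      refine eventually_exists_of_complete hU (hG a) ?_
      filter_upwards [hSU, hfine' (Sum.inr a)] with A hA ha using ⟨_, hA, ha, rfl⟩
    choose p hp using h5
    obtain ⟨x, hx⟩ := hnormal.exists_eventually (P := fun A x => ∃ a, x = Sum.inr a ∧
        ∃ (hA : A ∈ S) (ha : Sum.inr a ∈ A.1), p a ≠ s A hA ⟨a, ha⟩) (by
      filter_upwards [hSU, hfine' (Sum.inl p)] with A hA hpA
      obtain ⟨a, ha⟩ := hs A hA p hpA
      exact ⟨_, a.2, a.1, rfl, hA, a.2, ha⟩)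
    obtain ⟨a, rfl, -⟩ := hx.exists.choose_spec
    obtain ⟨A, ⟨a', ha', hA, ha, hne⟩, hA', haA', heq⟩ := (hx.and (hp a)).exists
    cases ha'
    exact hne heq.symm
  obtain ⟨A, hA1, hA2⟩ := (h1.and h2).exists
  obtain ⟨d, hd⟩ := exists_lt_of_card_lt h.isRegular (S := Sum.inr ⁻¹' A.1)
    ((mk_preimage_of_injective _ _ Sum.inr_injective).trans_lt A.2)
  obtain ⟨d', hd'⟩ := exists_lt_of_card_lt h.isRegular (S := {d})
    (by simpa using one_lt_aleph0.trans h.1)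
  refine ⟨d, d', hd' d rfl, ?_⟩
  -- No compatibility between these homomorphisms is needed: edges are tested at each index
  -- separately.
  have f : ∀ a : {a // Sum.inr a ∈ A.1}, E d →r E a.1 := fun a =>
    (hom a.1 d (hd a.1 a.2).le).some
  choose p hpA hp using fun x : G d => hA2 fun a => f a x
  refine ⟨⟨fun x => p x d', fun {x y} hxy => ?_⟩⟩
  refine hA1 (p x) (p y) (hpA x) (hpA y) (fun a ha => ?_) d'
  have hx := hp x ⟨a, ha⟩
  have hy := hp y ⟨a, ha⟩
  simp only at hx hy
  rw [hx, hy]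
  exact (f ⟨a, ha⟩).map_rel hxy

/-! ## Supercompactness up to a supercompact cardinal -/

/-- A cardinal that is supercompact up to a supercompact cardinal is supercompact. -/
theorem IsSupercompact.of_forall_lt {μ κ : Cardinal.{u}} (hμ : ℵ₀ < μ) (hμκ : μ ≤ κ)
    (hκ : IsSupercompact κ) (h : ∀ c < κ, ∃ Y : Type u, #Y = c ∧ IsSupercompactFor μ Y) :
    IsSupercompact μ := by
  refine ⟨hμ, fun X => ?_⟩
  obtain ⟨W, hW, hWfine, hWnormal⟩ := hκ.2 X
  have h' : ∀ A : SmallSubset κ X, ∃ (Y : Type u) (e : Y ≃ A.1), IsSupercompactFor μ Y := fun A => by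
    obtain ⟨Y, hY, hY'⟩ := h _ A.2
    exact ⟨Y, (Cardinal.eq.1 hY).some, hY'⟩
  choose Y e V hV hVfine hVnormal using h'
  let push (A : SmallSubset κ X) (a : SmallSubset μ (Y A)) : SmallSubset μ X :=
    ⟨(fun y => (e A y).1) '' a.1, mk_image_le.trans_lt a.2⟩
  -- A set has measure one if, for almost all `A`, it contains almost all small subsets of `A`.
  let U : Ultrafilter (SmallSubset μ X) := W.bind fun A => (V A).map (push A)
  have hU : ∀ S : Set (SmallSubset μ X), S ∈ U ↔ ∀ᶠ A in W, ∀ᶠ a in V A, push A a ∈ S :=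
    fun S => Iff.rfl
  refine ⟨U, ⟨fun T hT hTU => ?_⟩, fun x => ?_, fun S hS f hf => ?_⟩
  · have h1 : ∀ᶠ A in (W : Filter (SmallSubset κ X)), ∀ s : T, ∀ᶠ a in V A, push A a ∈ s.1 :=
      (eventually_cardinal_forall (hT.trans_le hμκ)).2 fun s => (hU _).1 (hTU _ s.2)
    refine (hU _).2 ?_
    filter_upwards [h1] with A hA
    have h2 : ∀ᶠ a in (V A : Filter (SmallSubset μ (Y A))), ∀ s : T, push A a ∈ s.1 :=
      (eventually_cardinal_forall hT).2 hA
    filter_upwards [h2] with a ha s hs using ha ⟨s, hs⟩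
  · refine (hU _).2 ?_
    filter_upwards [eventually_mem_of_isFine hWfine x] with A hA
    filter_upwards [eventually_mem_of_isFine (hVfine A) ((e A).symm ⟨x, hA⟩)] with a ha
    exact ⟨_, ha, by simp⟩
  · have h1 := (hU _).1 hS
    -- Normality of `V A` yields a constant value for each `A`. This value lies in `A`, so normality
    -- of `W` makes it independent of `A`.
    obtain ⟨x, hx⟩ := hWnormal.exists_eventually
      (P := fun A x => ∀ᶠ a in V A, ∃ h : push A a ∈ S, f ⟨_, h⟩ = x) (by
      filter_upwards [h1] with A hA
      obtain ⟨y, hy⟩ := (hVnormal A).exists_eventually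
        (P := fun a y => ∃ h : push A a ∈ S, f ⟨_, h⟩ = (e A y).1) (by
        filter_upwards [hA] with a ha
        obtain ⟨y, hy, hy'⟩ := hf ⟨_, ha⟩
        exact ⟨y, hy, ha, hy'.symm⟩)
      exact ⟨_, (e A y).2, hy⟩)
    exact ⟨x, (hU _).2 hx⟩

/-! ## Coding relational structures by graphs -/

section Coding

variable {B B' : Type u}

/-- The vertices of the graph that codes a sequence of quaternary relations: labels, elements of the
structure, and the four coordinates of every tuple that is in one of the relations. -/
inductive CodeVertex (R : ℕ → (Fin 4 → B) → Prop) : Type u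
  | label (n : ℕ)
  | elem (b : B)
  | coord (i : ℕ) (x : Fin 4 → B) (h : R i x) (j : Fin 4)

open CodeVertex

/-- The edges of the graph that codes a sequence of quaternary relations. -/
def CodeAdj (R : ℕ → (Fin 4 → B) → Prop) : CodeVertex R → CodeVertex R → Prop
  | label m, label n => n = m + 1 ∨ n = m + 2 ∨ (m = 1 ∧ n = 0)
  | label m, elem _ => m = 2 ∨ m = 5
  | label m, coord i _ _ j => m = 4 * i + j + 8
  | coord _ x _ j, elem b => x j = b
  | coord i x _ j, coord i' x' _ k => i = i' ∧ x = x' ∧ j < k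
  | _, _ => False

variable {R : ℕ → (Fin 4 → B) → Prop} {R' : ℕ → (Fin 4 → B') → Prop}

/-- The edge from label 1 back to label 0 is the only one that does not go up in the natural order
of the vertices. The unique 2-cycle it creates anchors every homomorphism. -/
theorem codeAdj_two_cycle {v w : CodeVertex R} (h : CodeAdj R v w) (h' : CodeAdj R w v) :
    (v = label 0 ∧ w = label 1) ∨ (v = label 1 ∧ w = label 0) := by
  rcases v with m | b | ⟨i, x, hx, j⟩ <;> rcases w with n | b' | ⟨i', x', hx', j'⟩ <;>
    simp only [CodeAdj] at h h'
  · simp only [label.injEq]; omega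
  · exact absurd (h.2.2.trans h'.2.2) (lt_irrefl _)

theorem codeAdj_consecutive {n : ℕ} {v : CodeVertex R} (h : CodeAdj R (label n) v)
    (h' : CodeAdj R (label (n + 1)) v) : v = label (n + 2) := by
  rcases v with m | b | ⟨i, x, hx, j⟩ <;> simp only [CodeAdj] at h h'
  · simp only [label.injEq]; omega
  · omega
  · omega

/-- The 2-cycle on labels 0 and 1 goes to itself, and each later label is the only common successor
of the two labels before it, so all labels are fixed once 0 and 1 are. -/
theorem codeHom_label (f : CodeAdj R →r CodeAdj R') (n : ℕ) : f (label n) = label n := by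
  have adj : ∀ m n, (n = m + 1 ∨ n = m + 2 ∨ (m = 1 ∧ n = 0)) →
      CodeAdj R' (f (label m)) (f (label n)) := fun m n h => f.map_rel (a := label m) h
  have h01 : f (label 0) = label 0 ∧ f (label 1) = label 1 := by
    rcases codeAdj_two_cycle (adj 0 1 (by simp)) (adj 1 0 (by simp)) with h | ⟨h0, h1⟩
    · exact h
    -- A swap of 0 and 1 still fixes 2. The image of 3 would then be a common successor of 0 and 2,
    -- and there is none.
    · have h2 : f (label 2) = label 2 := by
        have h02 := adj 0 2 (by simp)
        have h12 := adj 1 2 (by simp)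
        rw [h0] at h02; rw [h1] at h12
        exact codeAdj_consecutive h12 h02
      have h13 := adj 1 3 (by simp)
      have h23 := adj 2 3 (by simp)
      rw [h1] at h13; rw [h2] at h23
      exfalso
      revert h13 h23
      rcases f (label 3) with m | b | ⟨i, x, hx, j⟩ <;> simp only [CodeAdj] <;> omega
  have h : ∀ n, f (label n) = label n ∧ f (label (n + 1)) = label (n + 1) := by
    intro n
    induction n with
    | zero => exact h01
    | succ n ih =>
      refine ⟨ih.2, ?_⟩
      have h02 := adj n (n + 2) (by simp)
      have h12 := adj (n + 1) (n + 2) (by simp)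
      rw [ih.1] at h02; rw [ih.2] at h12
      exact codeAdj_consecutive h02 h12
  exact (h n).1

/-- Labels 2 and 5 are too far apart to have a label as common successor, and the labels that point
at coordinates start at 8. Only elements are successors of both. -/
theorem codeHom_elem (f : CodeAdj R →r CodeAdj R') (b : B) : ∃ b', f (elem b) = elem b' := by
  have h2 : CodeAdj R' (f (label 2)) (f (elem b)) := f.map_rel (a := label 2) (Or.inl rfl)
  have h5 : CodeAdj R' (f (label 5)) (f (elem b)) := f.map_rel (a := label 5) (Or.inr rfl)
  rw [codeHom_label] at h2 h5
  revert h2 h5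
  rcases f (elem b) with m | b | ⟨i, x, hx, j⟩ <;> simp only [CodeAdj]
  · omega
  · simp
  · omega

/-- A homomorphism between the graphs that code two structures is induced by a homomorphism between
the structures. -/
theorem codeHom_induced (f : CodeAdj R →r CodeAdj R') :
    ∃ g : B → B', (∀ b, f (elem b) = elem (g b)) ∧
      ∀ i x (h : R i x), ∃ h' : R' i (g ∘ x), ∀ j, f (coord i x h j) = coord i (g ∘ x) h' j := by
  choose g hg using codeHom_elem f
  refine ⟨g, hg, fun i x h => ?_⟩
  have h1 : ∀ j, ∃ (x' : Fin 4 → B') (h' : R' i x'), f (coord i x h j) = coord i x' h' j ∧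
      x' j = g (x j) := by
    intro j
    have hl : CodeAdj R' (f (label (4 * i + j + 8))) (f (coord i x h j)) :=
      f.map_rel (a := label (4 * i + j + 8)) rfl
    have he : CodeAdj R' (f (coord i x h j)) (f (elem (x j))) :=
      f.map_rel (a := coord i x h j) rfl
    rw [codeHom_label] at hl
    rw [hg] at he
    revert hl he
    rcases f (coord i x h j) with m | b | ⟨i', x', hx', j'⟩ <;> simp only [CodeAdj]
    · omega
    · simp
    · intro hl he
      obtain rfl : i' = i := by omega
      obtain rfl : j' = j := by omega
      exact ⟨x', hx', rfl, he⟩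
  choose x' hx' hf hxg using h1
  -- So far each coordinate vertex could land on a different tuple. The edges between the
  -- coordinates of one tuple force a single target tuple.
  have h2 : ∀ j, x' j = x' 0 := by
    intro j
    rcases Fin.eq_zero_or_eq_succ j with rfl | ⟨k, rfl⟩
    · rfl
    · have : CodeAdj R' (f (coord i x h 0)) (f (coord i x h k.succ)) :=
        f.map_rel (a := coord i x h 0) ⟨rfl, rfl, k.succ_pos⟩
      rw [hf, hf] at this
      exact this.2.1.symm
  have h3 : x' 0 = g ∘ x := funext fun j => by rw [← h2 j, hxg]; rfl
  have h4 : ∀ j, x' j = g ∘ x := fun j => (h2 j).trans h3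
  refine ⟨h3 ▸ hx' 0, fun j => ?_⟩
  rw [hf]
  congr 1
  exact h4 j

theorem codeHom_eq_id (f : CodeAdj R →r CodeAdj R) (h : ∀ b, f (elem b) = elem b)
    (v : CodeVertex R) : f v = v := by
  obtain ⟨g, hg, hf⟩ := codeHom_induced f
  have : g = id := funext fun b => by simpa using (hg b).symm.trans (h b)
  subst this
  rcases v with m | b | ⟨i, x, hx, j⟩
  · exact codeHom_label f m
  · exact h b
  · exact (hf i x hx).choose_spec j

theorem mk_codeVertex_le (R : ℕ → (Fin 4 → B) → Prop) : #(CodeVertex R) ≤ max ℵ₀ #B := by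
  let f : CodeVertex R → ℕ ⊕ B ⊕ (ℕ × (Fin 4 → B) × Fin 4) := fun
    | label n => Sum.inl n
    | elem b => Sum.inr (Sum.inl b)
    | coord i x _ j => Sum.inr (Sum.inr (i, x, j))
  have hf : Function.Injective f := by
    rintro (_ | _ | _) (_ | _ | _) <;> simp +contextual [f]
  have hm : ℵ₀ ≤ max ℵ₀ #B := le_max_left _ _
  have h4 : #(Fin 4 → B) ≤ max ℵ₀ #B := by
    rw [mk_pi, prod_const]
    simp only [lift_uzero, mk_fin, lift_natCast]
    refine (power_le_power_right (le_max_right ℵ₀ _)).trans ?_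
    rw [power_natCast]
    exact power_nat_le hm
  refine (mk_le_of_injective hf).trans ?_
  rw [mk_sum, mk_sum, mk_prod, mk_prod, mk_nat]
  simp only [lift_id, lift_aleph0, lift_uzero]
  refine add_le_of_le hm hm (add_le_of_le hm (le_max_right _ _) ?_)
  refine mul_le_of_le hm hm (mul_le_of_le hm h4 ?_)
  simp

end Coding

/-! ## Rigid structures on initial segments of a well-order -/

section Rigid

variable {K : Type u} [LinearOrder K]

/-- A function from the initial segment of elements less than `dom` to itself, extended by the
identity. -/
@[ext] structure SegFun (K : Type u) [LinearOrder K] where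
  dom : K
  val : K → K
  val_lt : ∀ a < dom, val a < dom
  val_out : ∀ a, dom ≤ a → val a = a

open Classical in
/-- The self-map of an initial segment given by a function that preserves the segment. -/
def SegFun.of (ε : K) (f : K → K) (hf : ∀ a < ε, f a < ε) : SegFun K where
  dom := ε
  val a := if a < ε then f a else a
  val_lt a ha := by simpa [ha] using hf a ha
  val_out a ha := by simp [ha.not_gt]

theorem SegFun.of_val {ε : K} {f : K → K} (hf : ∀ a < ε, f a < ε) {a : K} (ha : a < ε) :
    (SegFun.of ε f hf).val a = f a := by simp [SegFun.of, ha]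

/-- There is a homomorphism from the graph `E` on the elements less than `γ` to the graph `E'` on
the elements less than `γ'`. -/
def SegHom (γ : K) (E : K → K → Prop) (γ' : K) (E' : K → K → Prop) : Prop :=
  ∃ f : K → K, (∀ x < γ, f x < γ') ∧ ∀ x < γ, ∀ y < γ, E x y → E' (f x) (f y)

/-- `ε` is the supremum of the values of a function on an initial segment below `ε`. -/
def IsCofinalSeg (F : SegFun K) (θ : K) : Prop :=
  θ < F.dom ∧ ∀ b < F.dom, ∃ a ≤ θ, b ≤ F.val a

/-- `F` is a predecessor function. -/
def IsPredFun (F : SegFun K) : Prop :=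
  ∀ a < F.dom, IsMin a ∨ F.val a ⋖ a

/-- `A` is an injection from the elements less than `ε` to bounded functions on the elements less
than some `θ < ε`. -/
def IsPowerInjection (ε θ : K) (A : K → K → K) : Prop :=
  θ < ε ∧ (∀ a < ε, ∀ x < ε, A a x ≤ θ) ∧ ∀ a < ε, ∀ b < ε, a ≠ b → ∃ x < θ, A a x ≠ A b x

/-- `(γ, E)` is a sequence of graphs with homomorphisms backwards but not forwards. -/
def IsBackwardSeq (ε : K) (γ : K → K) (E : K → K → K → Prop) : Prop :=
  (∀ a < ε, ∃ b, a < b ∧ b < ε) ∧ (∀ a < ε, γ a < ε) ∧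
    (∀ a b, a ≤ b → b < ε → SegHom (γ b) (E b) (γ a) (E a)) ∧
    ∀ a b, a < b → b < ε → ¬ SegHom (γ a) (E a) (γ b) (E b)

/-- The elements of the rigid structures: points and functions. -/
abbrev RigidElem (K : Type u) [LinearOrder K] : Type u := K ⊕ SegFun K

/-- The level of a point or a function. -/
def RigidElem.rank : RigidElem K → K
  | Sum.inl a => a
  | Sum.inr F => F.dom

variable (θ : K → K) (A : K → K → K → K) (γ : K → K → K) (E : K → K → K → K → Prop)

/-- The relations of the rigid structures. -/
def RigidRel (δ : K) (i : ℕ) (x : Fin 4 → RigidElem K) : Prop :=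
  match i with
  | 0 => ∃ a, x 0 = Sum.inl a
  | 1 => ∃ a, x 0 = Sum.inl a ∧ IsMin a
  | 2 => x 0 = Sum.inl δ
  | 3 => ∃ a b, x 0 = Sum.inl a ∧ x 1 = Sum.inl b ∧ a < b
  | 4 => ∃ F, x 0 = Sum.inr F ∧ x 1 = Sum.inl F.dom
  | 5 => ∃ F a, x 0 = Sum.inr F ∧ a < F.dom ∧ x 1 = Sum.inl a ∧ x 2 = Sum.inl (F.val a)
  | 6 => ∃ F a, x 0 = Sum.inr F ∧ x 1 = Sum.inl a ∧ IsCofinalSeg F a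
  | 7 => ∃ F, x 0 = Sum.inr F ∧ IsPredFun F
  | 8 => ∃ F a, x 0 = Sum.inr F ∧ x 1 = Sum.inl a ∧ x 2 = Sum.inl (θ F.dom) ∧
      IsPowerInjection F.dom (θ F.dom) (A F.dom) ∧ ∀ y < F.dom, F.val y = A F.dom a y
  | 9 => ∃ F, x 0 = Sum.inr F ∧ ∀ a < F.dom, ∃ y < θ F.dom, F.val y ≠ A F.dom a y
  | 10 => ∃ ε a, x 0 = Sum.inl ε ∧ x 1 = Sum.inl a ∧ x 2 = Sum.inl (γ ε a) ∧
      IsBackwardSeq ε (γ ε) (E ε)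
  | 11 => ∃ ε a y z, x 0 = Sum.inl ε ∧ x 1 = Sum.inl a ∧ x 2 = Sum.inl y ∧ x 3 = Sum.inl z ∧
      E ε a y z
  | 12 => ∃ ε a y z, x 0 = Sum.inl ε ∧ x 1 = Sum.inl a ∧ x 2 = Sum.inl y ∧ x 3 = Sum.inl z ∧
      ¬ E ε a y z
  | 13 => ∃ F, x 0 = Sum.inr F ∧ ∀ a < F.dom, F.val a < γ F.dom a
  | 14 => ∃ F F', x 0 = Sum.inr F ∧ x 1 = Sum.inr F' ∧ F.dom = F'.dom ∧
      ∀ a < F.dom, E F.dom a (F.val a) (F'.val a)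
  | _ => False

/-- The universe of the rigid structure with greatest point `δ`. -/
abbrev RigidUniv (δ : K) : Type u := {b : RigidElem K // b.rank ≤ δ}

/-- The relations of the rigid structure with greatest point `δ`. -/
def RigidStr (δ : K) (i : ℕ) (x : Fin 4 → RigidUniv δ) : Prop :=
  RigidRel θ A γ E δ i fun j => (x j).1

variable {θ A γ E}

/-- The maps of points and functions induced by a homomorphism between the rigid structures. -/
theorem exists_maps_of_hom {δ δ' : K} {g : RigidUniv δ → RigidUniv δ'}
    (hg : ∀ i x, RigidStr θ A γ E δ i x → RigidStr θ A γ E δ' i (g ∘ x)) :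
    ∃ (p : K → K) (f : SegFun K → SegFun K),
      (∀ b : RigidUniv δ, (g b).1 = Sum.map p f b.1) ∧
      ∀ i x, (∀ j, (x j).rank ≤ δ) → RigidRel θ A γ E δ i x →
        RigidRel θ A γ E δ' i fun j => Sum.map p f (x j) := by
  -- Relation 0 sends points to points; relation 4 does the same for functions.
  have h1 : ∀ a, a ≤ δ → ∃ a', ∀ h : RigidElem.rank (Sum.inl a) ≤ δ,
      (g ⟨Sum.inl a, h⟩).1 = Sum.inl a' := by
    intro a ha
    obtain ⟨a', ha'⟩ := hg 0 (fun _ => ⟨Sum.inl a, ha⟩) ⟨a, rfl⟩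
    exact ⟨a', fun _ => ha'⟩
  have h2 : ∀ F : SegFun K, F.dom ≤ δ → ∃ F', ∀ h : RigidElem.rank (Sum.inr F) ≤ δ,
      (g ⟨Sum.inr F, h⟩).1 = Sum.inr F' := by
    intro F hF
    obtain ⟨F', hF', -⟩ := hg 4 ![⟨Sum.inr F, hF⟩, ⟨Sum.inl F.dom, hF⟩, ⟨Sum.inr F, hF⟩,
      ⟨Sum.inr F, hF⟩] ⟨F, rfl, rfl⟩
    exact ⟨F', fun _ => hF'⟩
  have : Nonempty K := ⟨δ⟩
  choose! p hp using h1
  have : ∃ f : SegFun K → SegFun K, ∀ F, F.dom ≤ δ → ∀ h : RigidElem.rank (Sum.inr F) ≤ δ,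
      (g ⟨Sum.inr F, h⟩).1 = Sum.inr (f F) := by
    classical
    refine ⟨fun F => if h : F.dom ≤ δ then (h2 F h).choose else F, fun F hF h => ?_⟩
    simp only [hF, dif_pos]
    exact (h2 F hF).choose_spec h
  obtain ⟨f, hf⟩ := this
  have h3 : ∀ b : RigidUniv δ, (g b).1 = Sum.map p f b.1 := by
    rintro ⟨a | F, h⟩
    · exact hp a h h
    · exact hf F h h
  refine ⟨p, f, h3, fun i x hx hR => ?_⟩
  have := hg i (fun j => ⟨x j, hx j⟩) hR
  simp only [RigidStr, Function.comp_apply, h3] at this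
  exact this

/-! ### Certificates against a least moved point -/

section Crit

variable {δ δ' : K} {p : K → K} {f : SegFun K → SegFun K}
  (hpf : ∀ i x, (∀ j, (x j).rank ≤ δ) → RigidRel θ A γ E δ i x →
    RigidRel θ A γ E δ' i fun j => Sum.map p f (x j))

include hpf

theorem map_top : p δ = δ' := by
  have := hpf 2 (fun _ => Sum.inl δ) (fun _ => le_rfl) rfl
  simpa [RigidRel] using this

theorem map_isMin {a : K} (ha : a ≤ δ) (h : IsMin a) : p a = a := by
  have := hpf 1 (fun _ => Sum.inl a) (fun _ => ha) ⟨a, rfl, h⟩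
  simp only [RigidRel, Sum.map_inl, Sum.inl.injEq] at this
  obtain ⟨b, rfl, hb⟩ := this
  exact le_antisymm ((le_total _ _).elim id fun h' => hb h')
    ((le_total _ _).elim id fun h' => h h')

theorem map_lt {a b : K} (hb : b ≤ δ) (h : a < b) : p a < p b := by
  have := hpf 3 ![Sum.inl a, Sum.inl b, Sum.inl a, Sum.inl a]
    (by simpa [Fin.forall_fin_succ, RigidElem.rank] using ⟨h.le.trans hb, hb, h.le.trans hb⟩) ⟨a, b, rfl, rfl, h⟩
  simpa [RigidRel] using this

theorem map_dom {F : SegFun K} (hF : F.dom ≤ δ) : (f F).dom = p F.dom := by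
  have := hpf 4 ![Sum.inr F, Sum.inl F.dom, Sum.inr F, Sum.inr F]
    (by simpa [Fin.forall_fin_succ, RigidElem.rank] using hF) ⟨F, rfl, rfl⟩
  simpa [RigidRel, eq_comm] using this

theorem map_val {F : SegFun K} (hF : F.dom ≤ δ) {a : K} (ha : a < F.dom) :
    (f F).val (p a) = p (F.val a) := by
  have := hpf 5 ![Sum.inr F, Sum.inl a, Sum.inl (F.val a), Sum.inr F]
    (by simpa [Fin.forall_fin_succ, RigidElem.rank] using
      ⟨hF, ha.le.trans hF, (F.val_lt a ha).le.trans hF, hF⟩) ⟨F, a, rfl, ha, rfl, rfl⟩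
  simp only [RigidRel, Sum.map_inl, Sum.map_inr, Matrix.cons_val, Sum.inr.injEq, Sum.inl.injEq]
    at this
  obtain ⟨_, _, rfl, -, rfl, h⟩ := this
  exact h.symm

/-- The least point that is moved is not the supremum of a shorter sequence. -/
theorem crit_not_isCofinalSeg {ε : K} (hε : ε ≤ δ) (hlt : ε < p ε) (hfix : ∀ a < ε, p a = a)
    {F : SegFun K} (hF : F.dom = ε) {a : K} (h : IsCofinalSeg F a) : False := by
  subst hF
  have := hpf 6 ![Sum.inr F, Sum.inl a, Sum.inr F, Sum.inr F]
    (by simpa [Fin.forall_fin_succ, RigidElem.rank] using ⟨hε, h.1.le.trans hε, hε⟩)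
    ⟨F, a, rfl, rfl, h⟩
  simp only [RigidRel, Sum.map_inl, Sum.map_inr, Matrix.cons_val, Sum.inr.injEq, Sum.inl.injEq]
    at this
  obtain ⟨_, _, rfl, rfl, -, h'⟩ := this
  rw [map_dom hpf hε, hfix a h.1] at h'
  -- The image of `F` is cofinal in `p ε` on the same fixed segment, so it reaches `ε` there. But on
  -- that segment it agrees with `F`, whose values stay below `ε`.
  obtain ⟨b, hb, hb'⟩ := h' _ hlt
  have hb2 := hb.trans_lt h.1
  have := map_val hpf hε hb2
  rw [hfix b hb2, hfix _ (F.val_lt b hb2)] at this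
  exact absurd (F.val_lt b hb2) (this ▸ hb').not_gt

/-- The image of `F` is a predecessor function on an initial segment that contains `ε`, so it gives
`ε` a predecessor unless `ε` is least, and the least point is fixed. -/
theorem crit_not_isPredFun {ε : K} (hε : ε ≤ δ) (hlt : ε < p ε) (hfix : ∀ a < ε, p a = a)
    {F : SegFun K} (hF : F.dom = ε) (h : IsPredFun F) : ∃ a, a ⋖ ε := by
  subst hF
  have := hpf 7 (fun _ => Sum.inr F) (fun _ => hε) ⟨F, rfl, h⟩
  simp only [RigidRel, Sum.map_inr, Sum.inr.injEq] at this
  obtain ⟨_, rfl, h'⟩ := this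
  rcases h' F.dom (by rwa [map_dom hpf hε]) with h0 | h0
  · exact absurd (map_isMin hpf hε h0) hlt.ne'
  · exact ⟨_, h0⟩

/-- The list of functions at `p ε` extends the list at `ε`. Its entry with index `ε` is new, yet
restricted to `ε` it is already an element of the first structure. Being unlisted at `ε` is
preserved (relation 9), so the restriction would be unlisted at `p ε` too, where it is the entry
`ε`. -/
theorem crit_not_isPowerInjection {ε : K} (hε : ε ≤ δ) (hlt : ε < p ε) (hfix : ∀ a < ε, p a = a)
    (h : IsPowerInjection ε (θ ε) (A ε)) : False := by
  have hθ := hfix _ h.1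
  have key : ∀ a < ε, IsPowerInjection (p ε) (θ ε) (A (p ε)) ∧ θ (p ε) = θ ε ∧
      ∀ x < ε, A (p ε) a x = A ε a x := by
    intro a ha
    have hF : ∀ x < ε, A ε a x < ε := fun x hx => (h.2.1 a ha x hx).trans_lt h.1
    let F := SegFun.of ε (A ε a) hF
    have hFd : F.dom ≤ δ := hε
    have := hpf 8 ![Sum.inr F, Sum.inl a, Sum.inl (θ ε), Sum.inr F]
      (by simpa [Fin.forall_fin_succ, RigidElem.rank] using ⟨hFd, ha.le.trans hε, h.1.le.trans hε, hFd⟩)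
      ⟨F, a, rfl, rfl, rfl, h, fun y hy => SegFun.of_val hF hy⟩
    simp only [RigidRel, Sum.map_inl, Sum.map_inr, Matrix.cons_val, Sum.inr.injEq, Sum.inl.injEq]
      at this
    obtain ⟨_, _, rfl, rfl, h1, h2, h3⟩ := this
    have hd : (f F).dom = p ε := map_dom hpf hFd
    rw [hd] at h1 h2 h3
    rw [← h1, hθ] at h2
    rw [hθ] at h1
    rw [hfix a ha] at h3
    refine ⟨h2, h1.symm, fun x hx => ?_⟩
    rw [← h3 x (hx.trans hlt)]
    have hv := map_val hpf hFd (a := x) hx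
    rwa [hfix x hx, SegFun.of_val hF hx, hfix _ (hF x hx)] at hv
  obtain ⟨h', hθ', -⟩ := key (θ ε) h.1
  -- The bound `θ ε` on the values, the same for both lists, is what makes the restriction a
  -- self-map of the segment below `ε`.
  have hB : ∀ x < ε, A (p ε) ε x < ε := fun x hx =>
    (h'.2.1 ε hlt x (hx.trans hlt)).trans_lt h.1
  let F := SegFun.of ε (A (p ε) ε) hB
  have hFd : F.dom ≤ δ := hε
  by_cases hex : ∃ a < ε, ∀ x < θ ε, A (p ε) ε x = A ε a x
  · obtain ⟨a, ha, hA⟩ := hex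
    obtain ⟨x, hx, hne⟩ := h'.2.2 ε hlt a (ha.trans hlt) ha.ne'
    exact hne ((hA x hx).trans ((key a ha).2.2 x (hx.trans h.1)).symm)
  · push Not at hex
    have := hpf 9 (fun _ => Sum.inr F) (fun _ => hε) ⟨F, rfl, fun a ha => by
      obtain ⟨x, hx, hne⟩ := hex a ha
      exact ⟨x, hx, by rwa [SegFun.of_val hB (hx.trans h.1)]⟩⟩
    simp only [RigidRel, Sum.map_inr, Sum.inr.injEq] at this
    obtain ⟨_, rfl, h1⟩ := this
    have hd : (f F).dom = p ε := map_dom hpf hFd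
    rw [hd, hθ'] at h1
    obtain ⟨x, hx, hne⟩ := h1 ε hlt
    have hx' := hx.trans h.1
    have hv := map_val hpf hFd (a := x) hx'
    rw [hfix x hx', SegFun.of_val hB hx', hfix _ (hB x hx')] at hv
    exact hne hv

/-- The sequence of graphs at `p ε` extends the one at `ε`. A vertex `x` of its graph with index `ε`
has images in all earlier graphs, and these form a self-map of the segment below `ε`, an element of
the first structure. The image of this element is defined at some `β` between `ε` and `p ε`, and its
value there as a function of `x` is a forbidden homomorphism from graph `ε` to graph `β`. -/
theorem crit_not_isBackwardSeq {ε : K} (hε : ε ≤ δ) (hlt : ε < p ε) (hfix : ∀ a < ε, p a = a)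
    (h : IsBackwardSeq ε (γ ε) (E ε)) : False := by
  have key : ∀ a < ε, γ (p ε) a = γ ε a ∧ IsBackwardSeq (p ε) (γ (p ε)) (E (p ε)) := by
    intro a ha
    have hγ := h.2.1 a ha
    have := hpf 10 ![Sum.inl ε, Sum.inl a, Sum.inl (γ ε a), Sum.inl a]
      (by simpa [Fin.forall_fin_succ, RigidElem.rank] using ⟨hε, ha.le.trans hε, hγ.le.trans hε, ha.le.trans hε⟩)
      ⟨ε, a, rfl, rfl, rfl, h⟩
    simp only [RigidRel, Sum.map_inl, Matrix.cons_val, Sum.inl.injEq] at this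
    obtain ⟨_, _, rfl, rfl, h1, h2⟩ := this
    rw [hfix a ha, hfix _ hγ] at h1
    exact ⟨h1.symm, h2⟩
  -- Homomorphisms only preserve relations; listing both edges and non-edges (relations 11 and 12)
  -- yields an equivalence.
  have keyE : ∀ a < ε, ∀ x < ε, ∀ y < ε, E (p ε) a x y ↔ E ε a x y := by
    intro a ha x hx y hy
    have hr : ∀ j, RigidElem.rank (![Sum.inl ε, Sum.inl a, Sum.inl x, Sum.inl y] j : RigidElem K) ≤ δ := by
      simpa [Fin.forall_fin_succ, RigidElem.rank] using
        ⟨hε, ha.le.trans hε, hx.le.trans hε, hy.le.trans hε⟩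
    by_cases hE : E ε a x y
    · have := hpf 11 ![Sum.inl ε, Sum.inl a, Sum.inl x, Sum.inl y] hr ⟨ε, a, x, y, rfl, rfl, rfl, rfl, hE⟩
      simp only [RigidRel, Sum.map_inl, Matrix.cons_val, Sum.inl.injEq] at this
      obtain ⟨_, _, _, _, rfl, rfl, rfl, rfl, h1⟩ := this
      rw [hfix a ha, hfix x hx, hfix y hy] at h1
      simp [hE, h1]
    · have := hpf 12 ![Sum.inl ε, Sum.inl a, Sum.inl x, Sum.inl y] hr ⟨ε, a, x, y, rfl, rfl, rfl, rfl, hE⟩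
      simp only [RigidRel, Sum.map_inl, Matrix.cons_val, Sum.inl.injEq] at this
      obtain ⟨_, _, _, _, rfl, rfl, rfl, rfl, h1⟩ := this
      rw [hfix a ha, hfix x hx, hfix y hy] at h1
      simp [hE, h1]
  have hmin : ∃ a, a < ε := by
    by_contra! hm
    exact hlt.ne' (map_isMin hpf hε fun b _ => hm b)
  obtain ⟨a₀, ha₀⟩ := hmin
  have h' := (key a₀ ha₀).2
  obtain ⟨β, hβ, hβ'⟩ := h'.1 ε hlt
  have hs : ∀ a, a < ε → SegHom (γ (p ε) ε) (E (p ε) ε) (γ ε a) (E ε a) := by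
    intro a ha
    obtain ⟨s, hs1, hs2⟩ := h'.2.2.1 a ε ha.le hlt
    rw [(key a ha).1] at hs1
    have hγ := h.2.1 a ha
    exact ⟨s, hs1, fun x hx y hy hxy => (keyE a ha _ ((hs1 x hx).trans hγ) _
      ((hs1 y hy).trans hγ)).1 (hs2 x hx y hy hxy)⟩
  have : Nonempty K := ⟨ε⟩
  choose! s hs1 hs2 using hs
  have hS : ∀ x, x < γ (p ε) ε → ∀ a < ε, s a x < ε := fun x hx a ha =>
    (hs1 a ha x hx).trans (h.2.1 a ha)
  refine h'.2.2.2 ε β hβ hβ' ?_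
  classical
  -- The thread of `x`. Relations 13 and 14 express that a thread stays inside the vertex sets and
  -- that two threads are adjacent at every index.
  let S (x : K) (hx : x < γ (p ε) ε) : SegFun K := SegFun.of ε (fun a => s a x) (hS x hx)
  have hSd : ∀ x hx, (S x hx).dom ≤ δ := fun x hx => hε
  have hfd : ∀ x hx, (f (S x hx)).dom = p ε := fun x hx => map_dom hpf (hSd x hx)
  have hSv : ∀ x hx, ∀ a < ε, (S x hx).val a = s a x := fun x hx a ha => SegFun.of_val _ ha
  refine ⟨fun x => if hx : x < γ (p ε) ε then (f (S x hx)).val β else x, fun x hx => ?_,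
    fun x hx y hy hxy => ?_⟩
  · have := hpf 13 (fun _ => Sum.inr (S x hx)) (fun _ => hε) ⟨_, rfl, fun a ha => by
      rw [hSv x hx a ha]
      exact hs1 a ha x hx⟩
    simp only [RigidRel, Sum.map_inr, Sum.inr.injEq] at this
    obtain ⟨_, rfl, h1⟩ := this
    rw [hfd x hx] at h1
    beta_reduce
    rw [dif_pos hx]
    exact h1 β hβ'
  · have := hpf 14 ![Sum.inr (S x hx), Sum.inr (S y hy), Sum.inr (S y hy), Sum.inr (S y hy)]
      (by simpa [Fin.forall_fin_succ, RigidElem.rank] using ⟨hSd x hx, hSd y hy⟩)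
      ⟨_, _, rfl, rfl, rfl, fun a ha => by
        rw [hSv x hx a ha, hSv y hy a ha]
        exact hs2 a ha x hx y hy hxy⟩
    simp only [RigidRel, Sum.map_inr, Matrix.cons_val, Sum.inr.injEq] at this
    obtain ⟨_, _, rfl, rfl, -, h1⟩ := this
    rw [hfd x hx] at h1
    beta_reduce
    rw [dif_pos hx, dif_pos hy]
    exact h1 β hβ'

/-- Since `p` is strictly increasing, the least moved point moves up, and each kind of certificate
excludes that. -/
theorem map_eq_self_of_witnesses [WellFoundedLT K]
    (hW : ∀ ε, (∃ F a, F.dom = ε ∧ IsCofinalSeg F a) ∨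
      ((∀ a, ¬ a ⋖ ε) ∧ ∃ F, F.dom = ε ∧ IsPredFun F) ∨
      IsPowerInjection ε (θ ε) (A ε) ∨ IsBackwardSeq ε (γ ε) (E ε)) :
    ∀ a ≤ δ, p a = a := by
  intro ε
  induction ε using WellFoundedLT.induction with | _ ε ih
  intro hε
  have hfix : ∀ a < ε, p a = a := fun a ha => ih a ha (ha.le.trans hε)
  by_contra hne
  have hlt : ε < p ε := by
    refine lt_of_le_of_ne (le_of_not_gt fun h => ?_) (Ne.symm hne)
    have := map_lt hpf hε h
    rw [hfix _ h] at this
    exact this.false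
  rcases hW ε with ⟨F, a, hF, h⟩ | ⟨hno, F, hF, h⟩ | h | h
  · exact crit_not_isCofinalSeg hpf hε hlt hfix hF h
  · obtain ⟨a, ha⟩ := crit_not_isPredFun hpf hε hlt hfix hF h
    exact hno a ha
  · exact crit_not_isPowerInjection hpf hε hlt hfix h
  · exact crit_not_isBackwardSeq hpf hε hlt hfix h

end Crit

/-- If every point has a witness to not being a critical point, then the graphs that code the rigid
structures have no non-identity homomorphisms between them. -/
theorem rigid_of_witnesses [WellFoundedLT K]
    (hW : ∀ ε, (∃ F a, F.dom = ε ∧ IsCofinalSeg F a) ∨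
      ((∀ a, ¬ a ⋖ ε) ∧ ∃ F, F.dom = ε ∧ IsPredFun F) ∨
      IsPowerInjection ε (θ ε) (A ε) ∨ IsBackwardSeq ε (γ ε) (E ε)) {δ δ' : K}
    (e : CodeAdj (RigidStr θ A γ E δ) →r CodeAdj (RigidStr θ A γ E δ')) :
    δ = δ' ∧ ∀ v, HEq (e v) v := by
  obtain ⟨g, hg, hgR⟩ := codeHom_induced e
  obtain ⟨p, f, hgpf, hpf⟩ := exists_maps_of_hom fun i x hx => (hgR i x hx).1
  have hp := map_eq_self_of_witnesses hpf hW
  obtain rfl : δ = δ' := (hp δ le_rfl).symm.trans (map_top hpf)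
  refine ⟨rfl, fun v => heq_of_eq (codeHom_eq_id e (fun b => ?_) v)⟩
  rw [hg]
  congr 1
  refine Subtype.ext ?_
  rw [hgpf]
  obtain ⟨a | F, hb⟩ := b
  · simp [hp a hb]
  · have hd : (f F).dom = F.dom := (map_dom hpf hb).trans (hp _ hb)
    -- A function is determined by its domain and its values, which are points and hence fixed.
    have : f F = F := by
      refine SegFun.ext hd (funext fun a => ?_)
      rcases lt_or_ge a F.dom with ha | ha
      · have := map_val hpf hb ha
        rwa [hp a (ha.le.trans hb), hp _ ((F.val_lt a ha).le.trans hb)] at this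
      · rw [F.val_out a ha, (f F).val_out a (hd ▸ ha)]
    simp [this]

end Rigid

/-! ## Points that have no witness to not being a critical point -/

section Segments

variable {K : Type u} [LinearOrder K] [WellFoundedLT K] {ε : K}

theorem exists_lt_mk_Iio_eq {c : Cardinal.{u}} (h : c.ord < Ordinal.typein (α := K) (· < ·) ε) :
    ∃ a < ε, #(Set.Iio a) = c := by
  obtain ⟨a, ha⟩ := Ordinal.typein_surj (· < · : K → K → Prop)
    (h.trans (Ordinal.typein_lt_type _ ε))
  refine ⟨a, ?_, ?_⟩
  · rw [← Ordinal.typein_lt_typein (· < · : K → K → Prop), ha]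
    exact h
  · have := Ordinal.card_typein (r := (· < · : K → K → Prop)) a
    rw [ha, card_ord] at this
    exact this.symm

theorem ord_lt_typein {c : Cardinal.{u}} (h : c < #(Set.Iio ε)) :
    c.ord < Ordinal.typein (α := K) (· < ·) ε := by
  have : #(Set.Iio ε) = (Ordinal.typein (α := K) (· < ·) ε).card :=
    (Ordinal.card_typein (r := (· < · : K → K → Prop)) ε).symm
  rw [this] at h
  by_contra! h'
  exact absurd (Ordinal.card_le_card h') (by simpa using h)

theorem exists_lt_mk_Iio_eq_of_lt {c : Cardinal.{u}} (h : c < #(Set.Iio ε)) :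
    ∃ a < ε, #(Set.Iio a) = c :=
  exists_lt_mk_Iio_eq (ord_lt_typein h)

/-- A failure of the strong limit property injects `ε` into the subsets of a smaller segment; their
characteristic functions form a forbidden list. -/
theorem isStrongLimit_of_not_isPowerInjection (hω : ℵ₀ < #(Set.Iio ε))
    (hpow : ∀ θ A, ¬ IsPowerInjection ε θ A) : IsStrongLimit #(Set.Iio ε) := by
  classical
  refine ⟨(aleph0_pos.trans hω).ne', fun l hl => ?_⟩
  by_contra! hle
  obtain ⟨a, ha, rfl⟩ := exists_lt_mk_Iio_eq_of_lt hl
  -- The points `b` and `c` are the two least ones and serve as truth values. The maximum with `b`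
  -- below keeps both values within the bound.
  obtain ⟨b, hb, hb1⟩ := exists_lt_mk_Iio_eq_of_lt (one_lt_aleph0.trans hω)
  obtain ⟨⟨c, hc⟩⟩ : Nonempty (Set.Iio b) := by
    rw [← mk_ne_zero_iff, hb1]
    exact one_ne_zero
  rw [← mk_set] at hle
  obtain ⟨i⟩ := hle
  refine hpow (max a b) (fun z x => if ∃ (hz : z < ε) (hx : x < a),
    (⟨x, hx⟩ : Set.Iio a) ∈ i ⟨z, hz⟩ then b else c) ⟨max_lt ha hb, ?_, ?_⟩
  · intro z _ x _
    beta_reduce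
    split_ifs
    · exact le_max_right _ _
    · exact (le_of_lt hc).trans (le_max_right _ _)
  · intro z hz z' hz' hne
    by_contra! h
    refine hne ?_
    have : i ⟨z, hz⟩ = i ⟨z', hz'⟩ := by
      ext ⟨x, hx⟩
      have hcb : c ≠ b := (show c < b from hc).ne
      have := h x (lt_max_of_lt_left hx)
      simp only [hz, hz', show x < a from hx, exists_true_left] at this
      split_ifs at this with h1 h2 h2
      · exact iff_of_true h1 h2
      · exact absurd this.symm hcb
      · exact absurd this hcb
      · exact iff_of_false h1 h2
    exact congrArg Subtype.val (i.injective this)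

end Segments

/-! ### Without certificates: regularity, uncountability, failure of SWVP -/

section Witnesses

variable {K : Type u} [LinearOrder K] {ε : K}

variable (hcof : ∀ F a, F.dom = ε → ¬ IsCofinalSeg F a)

include hcof

/-- Every function from a shorter initial segment is bounded. -/
theorem exists_bound_of_not_isCofinalSeg {a : K} (ha : a < ε) (f : K → K)
    (hf : ∀ x < ε, f x < ε) : ∃ b < ε, ∀ x ≤ a, f x < b := by
  by_contra! h
  refine hcof (SegFun.of ε f hf) a rfl ⟨ha, fun b hb => ?_⟩
  obtain ⟨x, hx, hxb⟩ := h b hb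
  exact ⟨x, hx, by rwa [SegFun.of_val hf (hx.trans_lt ha)]⟩

/-- For a successor, the constant function at the predecessor is a cofinal sequence. -/
theorem not_covBy_of_not_isCofinalSeg (a : K) : ¬ a ⋖ ε := fun h => by
  obtain ⟨b, hb, hab⟩ := exists_bound_of_not_isCofinalSeg hcof h.1 (fun _ => a) fun _ _ => h.1
  exact h.2 (hab a le_rfl) hb

theorem exists_bound_of_mk_le {S : Set K} (hS : ∀ x ∈ S, x < ε) {a : K} (ha : a < ε)
    (h : #S ≤ #(Set.Iio a)) : ∃ b < ε, ∀ x ∈ S, x < b := by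
  classical
  obtain ⟨i⟩ := h
  let f : K → K := fun x => if h : ∃ y : S, (i y).1 = x then h.choose.1 else a
  have hf : ∀ x < ε, f x < ε := by
    intro x _
    simp only [f]
    split_ifs with h
    · exact hS _ h.choose.2
    · exact ha
  obtain ⟨b, hb, hfb⟩ := exists_bound_of_not_isCofinalSeg hcof ha f hf
  refine ⟨b, hb, fun x hx => ?_⟩
  have hex : ∃ y : S, (i y).1 = (i ⟨x, hx⟩).1 := ⟨_, rfl⟩
  have : f (i ⟨x, hx⟩) = x := by
    simp only [f, dif_pos hex]
    have := i.injective (Subtype.ext hex.choose_spec)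
    rw [this]
  rw [← this]
  exact hfb _ (i ⟨x, hx⟩).2.le

theorem mk_Iio_lt_of_not_isCofinalSeg {a : K} (ha : a < ε) : #(Set.Iio a) < #(Set.Iio ε) := by
  by_contra! h
  obtain ⟨b, hb, hb'⟩ := exists_bound_of_mk_le hcof (fun x (hx : x ∈ Set.Iio ε) => hx) ha h
  exact (hb' b hb).false

/-- If all non-minimal points below `ε` had predecessors, these would form a predecessor function.
So there is a limit point below `ε`; its segment is infinite and of smaller cardinality than that of
`ε`. -/
theorem aleph0_lt_of_not_isPredFun (hpred : ∀ F, F.dom = ε → ¬ IsPredFun F) :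
    ℵ₀ < #(Set.Iio ε) := by
  classical
  have : ∃ a < ε, ¬ IsMin a ∧ ∀ b, ¬ b ⋖ a := by
    by_contra! h
    have h' : ∀ a < ε, ∃ b < ε, IsMin a ∨ b ⋖ a := by
      intro a ha
      by_cases hm : IsMin a
      · exact ⟨a, ha, Or.inl hm⟩
      · obtain ⟨b, hb⟩ := h a ha hm
        exact ⟨b, hb.1.trans ha, Or.inr hb⟩
    have : Nonempty K := ⟨ε⟩
    choose! f hf hf' using h'
    refine hpred (SegFun.of ε f hf) rfl fun a ha => ?_
    rw [SegFun.of_val hf ha]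
    exact hf' a ha
  obtain ⟨a, ha, hmin, hcov⟩ := this
  refine lt_of_le_of_lt ?_ (mk_Iio_lt_of_not_isCofinalSeg hcof ha)
  rw [not_isMin_iff] at hmin
  obtain ⟨b, hb⟩ := hmin
  have : Nonempty (Set.Iio a) := ⟨⟨b, hb⟩⟩
  have : NoMaxOrder (Set.Iio a) := ⟨fun x => by
    by_contra! h
    refine hcov x.1 ⟨x.2, fun y hy hya => ?_⟩
    exact absurd (h ⟨y, hya⟩) (not_le.2 hy)⟩
  have : Infinite (Set.Iio a) := NoMaxOrder.infinite
  exact aleph0_le_mk _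

variable [WellFoundedLT K]

theorem typein_eq_ord_of_not_isCofinalSeg :
    Ordinal.typein (α := K) (· < ·) ε = (#(Set.Iio ε)).ord := by
  refine le_antisymm (le_of_not_gt fun h => ?_) ?_
  · obtain ⟨a, ha, h'⟩ := exists_lt_mk_Iio_eq h
    exact (mk_Iio_lt_of_not_isCofinalSeg hcof ha).ne h'
  · rw [ord_le]
    exact (Ordinal.card_typein (r := (· < · : K → K → Prop)) ε).ge

theorem isRegular_of_not_isCofinalSeg (hω : ℵ₀ < #(Set.Iio ε)) :
    Cardinal.IsRegular #(Set.Iio ε) := by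
  refine ⟨hω.le, ?_⟩
  rw [← typein_eq_ord_of_not_isCofinalSeg hcof, ← Ordinal.type_Iio_lt, Ordinal.cof_type,
    Order.le_cof_iff]
  intro S hS
  by_contra! hlt
  obtain ⟨a, ha, hac⟩ := exists_lt_mk_Iio_eq_of_lt hlt
  obtain ⟨b, hb, hb'⟩ := exists_bound_of_mk_le hcof (S := Subtype.val '' S)
    (by rintro _ ⟨x, -, rfl⟩; exact x.2) ha (mk_image_le.trans hac.ge)
  obtain ⟨x, hx, hbx⟩ := hS ⟨b, hb⟩
  exact absurd (hb' x.1 ⟨x, hx, rfl⟩) (not_lt.2 hbx)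

/-- The order type of `ε` is an initial ordinal, so a counterexample to SWVP can be reindexed by the
points below `ε`. Its vertex sets are smaller than `ε`, so they can be replaced by initial segments.
-/
theorem exists_isBackwardSeq (h : ¬ SemiWeakVopenka #(Set.Iio ε)) : ∃ γ E, IsBackwardSeq ε γ E := by
  classical
  simp only [SemiWeakVopenka] at h
  push Not at h
  obtain ⟨G, R, hG, hback, hforw⟩ := h
  obtain ⟨φ⟩ : Nonempty (Set.Iio ε ≃o (#(Set.Iio ε)).ord.ToType) := by
    have : Ordinal.type (· < · : Set.Iio ε → Set.Iio ε → Prop) =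
        Ordinal.type (· < · : (#(Set.Iio ε)).ord.ToType → (#(Set.Iio ε)).ord.ToType → Prop) := by
      rw [Ordinal.type_Iio_lt, typein_eq_ord_of_not_isCofinalSeg hcof, Ordinal.type_toType]
    exact ⟨OrderIso.ofRelIsoLT (Ordinal.type_eq.1 this).some⟩
  have hγ : ∀ a : Set.Iio ε, ∃ γ < ε, #(Set.Iio γ) = #(G (φ a)) := fun a =>
    exists_lt_mk_Iio_eq_of_lt (hG _)
  choose γ hγε hγG using hγ
  have e : ∀ a, Set.Iio (γ a) ≃ G (φ a) := fun a => (Cardinal.eq.1 (hγG a)).some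
  let γ' : K → K := fun a => if ha : a < ε then γ ⟨a, ha⟩ else a
  have hγ' : ∀ a (ha : a < ε), γ' a = γ ⟨a, ha⟩ := fun a ha => dif_pos ha
  let E : K → K → K → Prop := fun a x y => ∃ (ha : a < ε) (hx : x < γ ⟨a, ha⟩) (hy : y < γ ⟨a, ha⟩),
    R _ (e ⟨a, ha⟩ ⟨x, hx⟩) (e ⟨a, ha⟩ ⟨y, hy⟩)
  have hE : ∀ a b (ha : a < ε) (hb : b < ε), SegHom (γ' a) (E a) (γ' b) (E b) ↔
      Nonempty (R (φ ⟨a, ha⟩) →r R (φ ⟨b, hb⟩)) := by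
    intro a b ha hb
    rw [hγ' a ha, hγ' b hb]
    constructor
    · rintro ⟨f, hf, hfE⟩
      refine ⟨⟨fun v => e ⟨b, hb⟩ ⟨f ((e ⟨a, ha⟩).symm v), hf _ ((e ⟨a, ha⟩).symm v).2⟩,
        fun {v w} hvw => ?_⟩⟩
      obtain ⟨_, _, _, h⟩ := hfE ((e ⟨a, ha⟩).symm v) ((e ⟨a, ha⟩).symm v).2
        ((e ⟨a, ha⟩).symm w) ((e ⟨a, ha⟩).symm w).2
        ⟨ha, ((e ⟨a, ha⟩).symm v).2, ((e ⟨a, ha⟩).symm w).2, by simpa using hvw⟩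
      exact h
    · rintro ⟨f⟩
      have hf : ∃ g : K → K, ∀ x (hx : x < γ ⟨a, ha⟩),
          g x = ((e ⟨b, hb⟩).symm (f (e ⟨a, ha⟩ ⟨x, hx⟩))).1 :=
        ⟨fun x => if hx : x < γ ⟨a, ha⟩ then ((e ⟨b, hb⟩).symm (f (e ⟨a, ha⟩ ⟨x, hx⟩))).1 else x,
          fun x hx => dif_pos hx⟩
      obtain ⟨g, hg⟩ := hf
      refine ⟨g, fun x hx => ?_, ?_⟩
      · rw [hg x hx]
        exact ((e ⟨b, hb⟩).symm _).2
      · rintro x hx y hy ⟨_, _, _, h⟩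
        rw [hg x hx, hg y hy]
        exact ⟨hb, ((e ⟨b, hb⟩).symm _).2, ((e ⟨b, hb⟩).symm _).2, by simpa using f.map_rel h⟩
  refine ⟨γ', E, fun a ha => ?_, fun a ha => by rw [hγ' a ha]; exact hγε _,
    fun a b hab hb => (hE b a hb (hab.trans_lt hb)).2 (hback _ _ (φ.monotone hab)),
    fun a b hab hb h => ?_⟩
  · have := not_covBy_of_not_isCofinalSeg hcof a
    rw [CovBy] at this
    push Not at this
    exact this ha
  · have := hforw (φ ⟨a, hab.trans hb⟩) (φ ⟨b, hb⟩) (φ.strictMono hab)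
    exact (not_isEmpty_iff.2 ((hE a b _ hb).1 h)) this

end Witnesses

/-! ## Large families of rigid graphs -/

/-- Below the least inaccessible cardinal for which Semi-Weak Vopěnka's Principle holds there is
a large family of graphs without non-identity homomorphisms. -/
theorem exists_rigid_family {κ : Cardinal.{u}} (hκ : IsInaccessible κ)
    (hmin : ∀ c < κ, IsInaccessible c → ¬ SemiWeakVopenka c) :
    ∃ (G : κ.ord.ToType → Type u) (R : ∀ a, G a → G a → Prop), (∀ a, #(G a) < κ) ∧
      ∀ a b, ∀ f : R a →r R b, a = b ∧ ∀ v, HEq (f v) v := by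
  classical
  have hlt : ∀ ε : κ.ord.ToType, #(Set.Iio ε) < κ := fun ε => by
    simpa using Cardinal.mk_Iio_lt ε
  have hW : ∀ ε : κ.ord.ToType, ∃ θ A γ E, (∃ F a, F.dom = ε ∧ IsCofinalSeg F a) ∨
      ((∀ a, ¬ a ⋖ ε) ∧ ∃ F, F.dom = ε ∧ IsPredFun F) ∨
      IsPowerInjection ε θ A ∨ IsBackwardSeq ε γ E := by
    intro ε
    by_contra! h
    -- Data that play no role in the certificate at hand receive arbitrary values.
    have h1 := fun F a hF hc => (h ε (fun a _ => a) (fun a => a) fun _ _ _ => True).1 F a hF hc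
    have h2 := fun F hF hp => (h ε (fun a _ => a) (fun a => a) fun _ _ _ => True).2.1
      (not_covBy_of_not_isCofinalSeg h1) F hF hp
    have hω := aleph0_lt_of_not_isPredFun h1 h2
    have hinacc : IsInaccessible #(Set.Iio ε) := isInaccessible_def.2 ⟨hω,
      isRegular_of_not_isCofinalSeg h1 hω, isStrongLimit_of_not_isPowerInjection hω
        fun θ A => (h θ A (fun a => a) fun _ _ _ => True).2.2.1⟩
    obtain ⟨γ, E, hE⟩ := exists_isBackwardSeq h1 (hmin _ (hlt ε) hinacc)
    exact (h ε (fun a _ => a) γ E).2.2.2 hE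
  choose θ A γ E hW using hW
  refine ⟨fun δ => CodeVertex (RigidStr θ A γ E δ), fun δ => CodeAdj _, fun δ => ?_,
    fun a b f => rigid_of_witnesses hW f⟩
  have hIic : #(Set.Iic δ) < κ := by
    rw [← Set.Iio_insert]
    exact mk_insert_le.trans_lt (add_lt_of_lt hκ.1.le (hlt δ) (one_lt_aleph0.trans hκ.1))
  refine (mk_codeVertex_le _).trans_lt (max_lt hκ.1 ?_)
  -- A function is recovered from its domain and the part of its graph up to `δ`, because it is the
  -- identity beyond its domain.
  let i : RigidUniv δ → Set.Iic δ ⊕ (Set.Iic δ × Set (Set.Iic δ × Set.Iic δ)) := fun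
    | ⟨Sum.inl a, h⟩ => Sum.inl ⟨a, h⟩
    | ⟨Sum.inr F, h⟩ => Sum.inr (⟨F.dom, h⟩, {x | F.val x.1 = x.2})
  have hi : Function.Injective i := by
    rintro ⟨a | F, h⟩ ⟨b | F', h'⟩ heq
    · simp only [i, Sum.inl.injEq] at heq
      cases heq
      rfl
    · simp [i] at heq
    · simp [i] at heq
    · simp only [i, Sum.inr.injEq, Prod.mk.injEq] at heq
      obtain ⟨hd, hv⟩ := heq
      replace hd := congrArg Subtype.val hd
      dsimp only at hd
      have : F = F' := by
        refine SegFun.ext hd (funext fun a => ?_)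
        rcases lt_or_ge a F.dom with ha | ha
        · have h1 : F.val a ≤ δ := (F.val_lt a ha).le.trans h
          have := (Set.ext_iff.1 hv (⟨a, ha.le.trans h⟩, ⟨F.val a, h1⟩)).1 rfl
          exact this.symm
        · rw [F.val_out a ha, F'.val_out a (hd ▸ ha)]
      subst this
      rfl
  refine (mk_le_of_injective hi).trans_lt ?_
  simp only [mk_sum, mk_prod, mk_set, lift_id]
  exact add_lt_of_lt hκ.1.le hIic (mul_lt_of_lt hκ.1.le hIic
    (hκ.isStrongLimit.isStrongPrelimit (mul_lt_of_lt hκ.1.le hIic hIic)))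

/-! ## Evaluation of formulas in a level of the cumulative hierarchy -/

section Realize

variable {o : Ordinal.{u}} {n : ℕ} {v : Empty → Level o} {xs : Fin n → Level o}

theorem Level.mem_of_mem (x : Level o) {z : ZFSet.{u}} (hz : z ∈ x.1) : z ∈ ZFSet.vonNeumann o :=
  ZFSet.isTransitive_vonNeumann o _ x.2 hz

theorem Level.forall_mem {x : Level o} {P : ZFSet.{u} → Prop} :
    (∀ z : Level o, z.1 ∈ x.1 → P z.1) ↔ ∀ z ∈ x.1, P z :=
  ⟨fun h z hz => h ⟨z, x.mem_of_mem hz⟩ hz, fun h z hz => h z.1 hz⟩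

theorem Level.exists_mem {x : Level o} {P : ZFSet.{u} → Prop} :
    (∃ z : Level o, z.1 ∈ x.1 ∧ P z.1) ↔ ∃ z ∈ x.1, P z :=
  ⟨fun ⟨z, hz⟩ => ⟨z.1, hz⟩, fun ⟨z, hz, hP⟩ => ⟨⟨z, x.mem_of_mem hz⟩, hz, hP⟩⟩

theorem Level.fst_mem {x y z : ZFSet.{u}} (h : ZFSet.pair x y ∈ z)
    (hz : z ∈ ZFSet.vonNeumann o) : x ∈ ZFSet.vonNeumann o := by
  have ht := ZFSet.isTransitive_vonNeumann o
  exact ht.mem_trans (by simp : x ∈ ({x} : ZFSet)) (ht.mem_trans (by simp [ZFSet.pair])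
    (ht.mem_trans h hz))

theorem Level.snd_mem {x y z : ZFSet.{u}} (h : ZFSet.pair x y ∈ z)
    (hz : z ∈ ZFSet.vonNeumann o) : y ∈ ZFSet.vonNeumann o := by
  have ht := ZFSet.isTransitive_vonNeumann o
  exact ht.mem_trans (by simp : y ∈ ({x, y} : ZFSet)) (ht.mem_trans (by simp [ZFSet.pair])
    (ht.mem_trans h hz))

theorem Level.components_mem {x y : ZFSet.{u}} (h : ZFSet.pair x y ∈ ZFSet.vonNeumann o) :
    x ∈ ZFSet.vonNeumann o ∧ y ∈ ZFSet.vonNeumann o := by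
  have ht := ZFSet.isTransitive_vonNeumann o
  exact ⟨ht.mem_trans (by simp : x ∈ ({x} : ZFSet)) (ht.mem_trans (by simp [ZFSet.pair]) h),
    ht.mem_trans (by simp : y ∈ ({x, y} : ZFSet)) (ht.mem_trans (by simp [ZFSet.pair]) h)⟩

@[simp] theorem realize_mem {x y : Fin n} :
    (mem x y).Realize v xs ↔ (xs x).1 ∈ (xs y).1 := Iff.rfl

@[simp] theorem realize_eql {x y : Fin n} :
    (eql x y).Realize v xs ↔ (xs x).1 = (xs y).1 :=
  Subtype.ext_iff

@[simp] theorem realize_conj {φ ψ : Fm n} :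
    (conj φ ψ).Realize v xs ↔ φ.Realize v xs ∧ ψ.Realize v xs := by
  simp [conj]

@[simp] theorem realize_disj {φ ψ : Fm n} :
    (disj φ ψ).Realize v xs ↔ φ.Realize v xs ∨ ψ.Realize v xs := by
  simp [disj]

@[simp] theorem realize_all {φ : Fin (n + 1) → Fm (n + 1)} :
    (all φ).Realize v xs ↔ ∀ a, (φ (Fin.last n)).Realize v (Fin.snoc xs a) := Iff.rfl

@[simp] theorem realize_ex {φ : Fin (n + 1) → Fm (n + 1)} :
    (ex φ).Realize v xs ↔ ∃ a, (φ (Fin.last n)).Realize v (Fin.snoc xs a) := by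
  simp [ex]

@[simp] theorem realize_allIn {a : Fin n} {φ : Fin (n + 1) → Fm (n + 1)} :
    (allIn a φ).Realize v xs ↔
      ∀ z : Level o, z.1 ∈ (xs a).1 → (φ (Fin.last n)).Realize v (Fin.snoc xs z) := by
  simp [allIn]

@[simp] theorem realize_exIn {a : Fin n} {φ : Fin (n + 1) → Fm (n + 1)} :
    (exIn a φ).Realize v xs ↔
      ∃ z : Level o, z.1 ∈ (xs a).1 ∧ (φ (Fin.last n)).Realize v (Fin.snoc xs z) := by
  simp [exIn]

@[simp] theorem realize_sub {x y : Fin n} :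
    (sub x y).Realize v xs ↔ (xs x).1 ⊆ (xs y).1 := by
  simp [sub, Level.forall_mem (P := fun z => z ∈ (xs y).1), ZFSet.subset_def]

@[simp] theorem realize_isEmpty {x : Fin n} :
    (isEmpty x).Realize v xs ↔ (xs x).1 = ∅ := by
  simp only [isEmpty, realize_all, BoundedFormula.realize_not, realize_mem, Fin.snoc_last,
    Fin.snoc_castSucc, ZFSet.eq_empty]
  exact ⟨fun h z hz => h ⟨z, (xs x).mem_of_mem hz⟩ hz, fun h z => h z.1⟩

@[simp] theorem realize_isUPair {p x y : Fin n} :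
    (isUPair p x y).Realize v xs ↔ (xs p).1 = {(xs x).1, (xs y).1} := by
  simp only [isUPair, realize_all, BoundedFormula.realize_iff, realize_mem, realize_disj,
    realize_eql, Fin.snoc_last, Fin.snoc_castSucc]
  constructor
  · intro h
    ext z
    rw [ZFSet.mem_pair]
    constructor
    · intro hz
      exact (h ⟨z, (xs p).mem_of_mem hz⟩).1 hz
    · rintro (rfl | rfl)
      · exact (h (xs x)).2 (Or.inl rfl)
      · exact (h (xs y)).2 (Or.inr rfl)
  · intro h z
    rw [h, ZFSet.mem_pair]

@[simp] theorem realize_isPair {p x y : Fin n} :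
    (isPair p x y).Realize v xs ↔ (xs p).1 = ZFSet.pair (xs x).1 (xs y).1 := by
  simp only [isPair, realize_ex, realize_conj, realize_isUPair, Fin.snoc_last, Fin.snoc_castSucc,
    ZFSet.pair_eq_singleton, ZFSet.pair]
  constructor
  · rintro ⟨s, t, hs, ht, h⟩
    rw [h, hs, ht]
  · intro h
    refine ⟨⟨_, (xs p).mem_of_mem (h ▸ ?_)⟩, ⟨_, (xs p).mem_of_mem (h ▸ ?_)⟩, rfl, rfl, h⟩ <;> simp

@[simp] theorem realize_pairMem {x y r : Fin n} :
    (pairMem x y r).Realize v xs ↔ ZFSet.pair (xs x).1 (xs y).1 ∈ (xs r).1 := by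
  simp only [pairMem, realize_exIn, realize_isPair, Fin.snoc_last, Fin.snoc_castSucc]
  rw [Level.exists_mem (P := fun z => z = ZFSet.pair (xs x).1 (xs y).1)]
  simp

@[simp] theorem realize_isFun {f a b : Fin n} :
    (isFun f a b).Realize v xs ↔ ZFSet.IsFunc (xs a).1 (xs b).1 (xs f).1 := by
  simp only [isFun, realize_conj, realize_allIn, realize_exIn, realize_all, realize_isPair,
    realize_pairMem, realize_eql, BoundedFormula.realize_imp, Fin.snoc_last, Fin.snoc_castSucc]
  constructor
  · rintro ⟨h, h'⟩
    refine ⟨fun p hp => ?_, fun x hx => ?_⟩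
    · obtain ⟨x, hx, y, hy, h⟩ := h ⟨p, (xs f).mem_of_mem hp⟩ hp
      exact ZFSet.mem_prod.2 ⟨x.1, hx, y.1, hy, h⟩
    · obtain ⟨y, hy, h1, h2⟩ := h' ⟨x, (xs a).mem_of_mem hx⟩ hx
      exact ⟨y.1, h1, fun z hz => h2 ⟨z, Level.snd_mem hz (xs f).2⟩ hz⟩
  · intro h
    refine ⟨fun p hp => ?_, fun x hx => ?_⟩
    · obtain ⟨x, hx, y, hy, h⟩ := ZFSet.mem_prod.1 (h.1 hp)
      exact ⟨⟨x, (xs a).mem_of_mem hx⟩, hx, ⟨y, (xs b).mem_of_mem hy⟩, hy, h⟩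
    · obtain ⟨y, hy, hy'⟩ := h.2 x.1 hx
      exact ⟨⟨y, Level.snd_mem hy (xs f).2⟩, (ZFSet.pair_mem_prod.1 (h.1 hy)).2, hy,
        fun z hz => hy' z.1 hz⟩

/-- `f` is an injective function from `x` to `y`. -/
def IsInjFunc (x y f : ZFSet.{u}) : Prop :=
  ZFSet.IsFunc x y f ∧ ∀ a b c, ZFSet.pair a c ∈ f → ZFSet.pair b c ∈ f → a = b

@[simp] theorem realize_isInj {f a b : Fin n} :
    (isInj f a b).Realize v xs ↔ IsInjFunc (xs a).1 (xs b).1 (xs f).1 := by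
  simp only [isInj, realize_conj, realize_all, realize_isFun, realize_pairMem, realize_eql,
    BoundedFormula.realize_imp, Fin.snoc_last, Fin.snoc_castSucc]
  refine and_congr_right fun _ => ?_
  constructor
  · intro h x y z hx hy
    exact h ⟨x, Level.fst_mem hx (xs f).2⟩ ⟨y, Level.fst_mem hy (xs f).2⟩
      ⟨z, Level.snd_mem hy (xs f).2⟩ ⟨hx, hy⟩
  · rintro h x y z ⟨hx, hy⟩
    exact h _ _ _ hx hy

@[simp] theorem realize_isTrans {x : Fin n} :
    (isTrans x).Realize v xs ↔ (xs x).1.IsTransitive := by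
  simp only [isTrans, realize_allIn, realize_sub, Fin.snoc_last, Fin.snoc_castSucc]
  exact Level.forall_mem (P := fun z => z ⊆ (xs x).1)

@[simp] theorem realize_isSet {x : Fin n} {v : Empty → Level (o + 1)} {xs : Fin n → Level (o + 1)} :
    (isSet x).Realize v xs ↔ (xs x).1 ∈ ZFSet.vonNeumann o := by
  simp only [isSet, realize_ex, realize_mem, Fin.snoc_last, Fin.snoc_castSucc]
  constructor
  · rintro ⟨y, hy⟩
    have h := y.2
    simp only [ZFSet.vonNeumann_add_one, ZFSet.mem_powerset] at h
    exact h hy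
  · intro h
    exact ⟨⟨ZFSet.vonNeumann o, by simp⟩, h⟩

@[simp] theorem realize_isOrd {x : Fin n} {v : Empty → Level (o + 1)} {xs : Fin n → Level (o + 1)} :
    (isOrd x).Realize v xs ↔ (xs x).1 ∈ ZFSet.vonNeumann o ∧ (xs x).1.IsOrdinal := by
  simp only [isOrd, realize_conj, realize_isSet, realize_isTrans, realize_allIn, Fin.snoc_last,
    ZFSet.isOrdinal_iff_forall_mem_isTransitive]
  rw [Level.forall_mem (P := fun z => z.IsTransitive)]

@[simp] theorem realize_allSet {v : Empty → Level (o + 1)} {xs : Fin n → Level (o + 1)}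
    {φ : Fin (n + 1) → Fm (n + 1)} :
    (allSet φ).Realize v xs ↔ ∀ z : Level (o + 1), z.1 ∈ ZFSet.vonNeumann o →
      (φ (Fin.last n)).Realize v (Fin.snoc xs z) := by
  simp [allSet]

@[simp] theorem realize_exSet {v : Empty → Level (o + 1)} {xs : Fin n → Level (o + 1)}
    {φ : Fin (n + 1) → Fm (n + 1)} :
    (exSet φ).Realize v xs ↔ ∃ z : Level (o + 1), z.1 ∈ ZFSet.vonNeumann o ∧
      (φ (Fin.last n)).Realize v (Fin.snoc xs z) := by
  simp [exSet]

/-- `g` is the graph with vertex set `x` and edge set `e`. -/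
def IsGraphOn (g x e : ZFSet.{u}) : Prop :=
  g = ZFSet.pair x e ∧ e ⊆ ZFSet.prod x x

/-- `h` is a homomorphism from the graph `⟨x, e⟩` to the graph `⟨x', e'⟩`. -/
def IsGraphHom (h x e x' e' : ZFSet.{u}) : Prop :=
  ZFSet.IsFunc x x' h ∧ ∀ a b, ZFSet.pair a b ∈ e →
    ∃ a' b', ZFSet.pair a a' ∈ h ∧ ZFSet.pair b b' ∈ h ∧ ZFSet.pair a' b' ∈ e'

@[simp] theorem realize_isGraphWith {g x e : Fin n} :
    (isGraphWith g x e).Realize v xs ↔ IsGraphOn (xs g).1 (xs x).1 (xs e).1 := by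
  simp only [isGraphWith, realize_conj, realize_isPair, realize_allIn, realize_exIn, Fin.snoc_last,
    Fin.snoc_castSucc]
  refine and_congr_right fun _ => ?_
  constructor
  · intro h p hp
    obtain ⟨a, ha, b, hb, h⟩ := h ⟨p, (xs e).mem_of_mem hp⟩ hp
    exact ZFSet.mem_prod.2 ⟨a.1, ha, b.1, hb, h⟩
  · intro h p hp
    obtain ⟨a, ha, b, hb, h⟩ := ZFSet.mem_prod.1 (h hp)
    exact ⟨⟨a, (xs x).mem_of_mem ha⟩, ha, ⟨b, (xs x).mem_of_mem hb⟩, hb, h⟩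

@[simp] theorem realize_isGraph {g : Fin n} :
    (isGraph g).Realize v xs ↔ ∃ x e, IsGraphOn (xs g).1 x e := by
  simp only [isGraph, realize_ex, realize_isGraphWith, Fin.snoc_last, Fin.snoc_castSucc]
  constructor
  · rintro ⟨x, e, h⟩
    exact ⟨_, _, h⟩
  · rintro ⟨x, e, h⟩
    have := Level.components_mem (h.1 ▸ (xs g).2)
    exact ⟨⟨x, this.1⟩, ⟨e, this.2⟩, h⟩

@[simp] theorem realize_isHom {h g g' : Fin n} :
    (isHom h g g').Realize v xs ↔ ∃ x e x' e', IsGraphOn (xs g).1 x e ∧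
      IsGraphOn (xs g').1 x' e' ∧ IsGraphHom (xs h).1 x e x' e' := by
  simp only [isHom, realize_ex, realize_conj, realize_all, BoundedFormula.realize_imp,
    realize_isGraphWith, realize_isFun, realize_pairMem, Fin.snoc_last, Fin.snoc_castSucc]
  constructor
  · rintro ⟨x, e, x', e', h1, h2, h3, h4⟩
    refine ⟨_, _, _, _, h1, h2, h3, fun a b hab => ?_⟩
    obtain ⟨a', b', h⟩ := h4 ⟨a, Level.fst_mem hab e.2⟩ ⟨b, Level.snd_mem hab e.2⟩ hab
    exact ⟨_, _, h⟩
  · rintro ⟨x, e, x', e', h1, h2, h3, h4⟩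
    have hg := Level.components_mem (h1.1 ▸ (xs g).2)
    have hg' := Level.components_mem (h2.1 ▸ (xs g').2)
    refine ⟨⟨x, hg.1⟩, ⟨e, hg.2⟩, ⟨x', hg'.1⟩, ⟨e', hg'.2⟩, h1, h2, h3, fun a b hab => ?_⟩
    obtain ⟨a', b', ha, hb, hab'⟩ := h4 a.1 b.1 hab
    exact ⟨⟨a', Level.snd_mem ha (xs h).2⟩, ⟨b', Level.snd_mem hb (xs h).2⟩, ha, hb, hab'⟩

@[simp] theorem realize_existsHom {g g' : Fin n} :
    (existsHom g g').Realize v xs ↔ ∃ h : Level o, ∃ x e x' e', IsGraphOn (xs g).1 x e ∧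
      IsGraphOn (xs g').1 x' e' ∧ IsGraphHom h.1 x e x' e' := by
  simp [existsHom]

@[simp] theorem realize_isOrdSeq {s : Fin n} {v : Empty → Level (o + 1)}
    {xs : Fin n → Level (o + 1)} :
    (isOrdSeq s).Realize v xs ↔
      (∀ p ∈ (xs s).1, ∃ a g, a ∈ ZFSet.vonNeumann o ∧ a.IsOrdinal ∧ (∃ x e, IsGraphOn g x e) ∧
        p = ZFSet.pair a g) ∧
      ∀ a ∈ ZFSet.vonNeumann o, a.IsOrdinal → ∃! g, ZFSet.pair a g ∈ (xs s).1 := by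
  simp only [isOrdSeq, realize_conj, realize_allIn, realize_ex, realize_isOrd, realize_isGraph,
    realize_isPair, realize_all, BoundedFormula.realize_imp, realize_pairMem, realize_eql,
    Fin.snoc_last, Fin.snoc_castSucc]
  refine and_congr ?_ ?_
  · constructor
    · intro h p hp
      obtain ⟨a, g, ha, hg, h⟩ := h ⟨p, (xs s).mem_of_mem hp⟩ hp
      exact ⟨a.1, g.1, ha.1, ha.2, hg, h⟩
    · intro h p hp
      obtain ⟨a, g, ha, ha', hg, h⟩ := h p.1 hp
      have := Level.components_mem (h ▸ p.2)
      exact ⟨⟨a, this.1⟩, ⟨g, this.2⟩, ⟨ha, ha'⟩, hg, h⟩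
  · constructor
    · intro h a ha ha'
      obtain ⟨g, hg, h⟩ := h ⟨a, ZFSet.vonNeumann_subset_of_le (by simp) ha⟩ ⟨ha, ha'⟩
      exact ⟨g.1, hg, fun g' hg' => h ⟨g', Level.snd_mem hg' (xs s).2⟩ hg'⟩
    · rintro h a ⟨ha, ha'⟩
      obtain ⟨g, hg, h⟩ := h a.1 ha ha'
      exact ⟨⟨g, Level.snd_mem hg (xs s).2⟩, hg, fun g' hg' => h g'.1 hg'⟩

end Realize

/-! ## Levels of the cumulative hierarchy at inaccessible cardinals -/

section Inaccessible

variable {κ : Cardinal.{u}}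

local notation "V" => ZFSet.vonNeumann (Cardinal.ord κ)

theorem isSuccLimit_ord (hκ : IsInaccessible κ) : Order.IsSuccLimit κ.ord :=
  Cardinal.isSuccLimit_ord hκ.1.le

theorem card_lt_of_mem_level (hκ : IsInaccessible κ) {x : ZFSet.{u}} (hx : x ∈ V) :
    x.card < κ := by
  have h1 : x.card ≤ preBeth x.rank := by
    rw [← ZFSet.card_vonNeumann]
    exact ZFSet.card_mono (ZFSet.subset_vonNeumann_self x)
  refine h1.trans_lt ?_
  rw [ZFSet.mem_vonNeumann] at hx
  conv_rhs => rw [← hκ.preBeth_ord]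
  exact preBeth_lt_preBeth.2 hx

/-- By regularity, the ranks of fewer than `κ` elements are bounded below `κ`. -/
theorem mem_level_of_card_lt (hκ : IsInaccessible κ) {x : ZFSet.{u}} (hx : x ⊆ V)
    (hc : x.card < κ) : x ∈ V := by
  rw [ZFSet.mem_vonNeumann]
  have hlim := SetTheoryModel.isSuccLimit_ord hκ
  let f : Shrink.{u} x → Ordinal.{u} := fun y => ((equivShrink x).symm y).1.rank + 1
  have h1 : ⨆ y, f y < κ.ord := by
    refine Ordinal.iSup_lt_of_lt_cof (by rwa [hκ.isRegular.cof_ord]) fun y => ?_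
    have := hx ((equivShrink x).symm y).2
    rw [ZFSet.mem_vonNeumann] at this
    exact hlim.add_one_lt this
  refine lt_of_le_of_lt (ZFSet.rank_le_iff.2 fun y hy => ?_) h1
  have h2 : f (equivShrink x ⟨y, hy⟩) ≤ ⨆ y, f y := Ordinal.le_iSup f _
  refine lt_of_lt_of_le ?_ h2
  simp [f]

theorem sUnion_mem_level {x : ZFSet.{u}} (hx : x ∈ V) : ZFSet.sUnion x ∈ V := by
  rw [ZFSet.mem_vonNeumann] at *
  exact (ZFSet.rank_sUnion_le x).trans_lt hx

variable (hκ : IsInaccessible κ)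

include hκ

theorem powerset_mem_level {x : ZFSet.{u}} (hx : x ∈ V) : x.powerset ∈ V := by
  rw [ZFSet.mem_vonNeumann] at *
  rw [ZFSet.rank_powerset]
  exact (SetTheoryModel.isSuccLimit_ord hκ).succ_lt hx

theorem upair_mem_level {x y : ZFSet.{u}} (hx : x ∈ V) (hy : y ∈ V) : ({x, y} : ZFSet) ∈ V := by
  have hlim := SetTheoryModel.isSuccLimit_ord hκ
  rw [ZFSet.mem_vonNeumann] at *
  rw [ZFSet.rank_pair]
  exact max_lt (hlim.succ_lt hx) (hlim.succ_lt hy)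

theorem pair_mem_level {x y : ZFSet.{u}} (hx : x ∈ V) (hy : y ∈ V) : ZFSet.pair x y ∈ V := by
  have := upair_mem_level hκ hx hx
  rw [ZFSet.pair_eq_singleton] at this
  exact upair_mem_level hκ this (upair_mem_level hκ hx hy)

theorem prod_mem_level {x y : ZFSet.{u}} (hx : x ∈ V) (hy : y ∈ V) : ZFSet.prod x y ∈ V := by
  have h : x ∪ y ∈ V := by
    rw [ZFSet.mem_vonNeumann] at *
    rw [ZFSet.rank_union]
    exact max_lt hx hy
  refine ZFSet.mem_vonNeumann_of_subset (fun p hp => ?_)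
    (powerset_mem_level hκ (powerset_mem_level hκ h))
  obtain ⟨a, ha, b, hb, rfl⟩ := ZFSet.mem_prod.1 hp
  rw [ZFSet.mem_powerset]
  intro s hs
  rw [ZFSet.mem_powerset]
  intro t ht
  rw [ZFSet.mem_union]
  rw [ZFSet.pair, ZFSet.mem_pair] at hs
  rcases hs with rfl | rfl
  · rw [ZFSet.mem_singleton] at ht
    exact Or.inl (ht ▸ ha)
  · rcases ZFSet.mem_pair.1 ht with rfl | rfl
    · exact Or.inl ha
    · exact Or.inr hb

end Inaccessible

theorem mem_level_add_one {o : Ordinal.{u}} {x : ZFSet.{u}} :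
    x ∈ ZFSet.vonNeumann (o + 1) ↔ x ⊆ ZFSet.vonNeumann o := by
  rw [ZFSet.vonNeumann_add_one, ZFSet.mem_powerset]

theorem mem_level_add_one_of_mem {o : Ordinal.{u}} {x : ZFSet.{u}} (h : x ∈ ZFSet.vonNeumann o) :
    x ∈ ZFSet.vonNeumann (o + 1) :=
  ZFSet.vonNeumann_subset_of_le (by simp) h

/-! ## The axioms of Gödel–Bernays set theory -/

section Axioms

variable {o : Ordinal.{u}} {κ : Cardinal.{u}}

theorem level_models_extensionality : Level o ⊨ extensionality := by
  simp only [extensionality, Sentence.Realize, Formula.Realize, realize_all,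
    BoundedFormula.realize_imp, BoundedFormula.realize_iff, realize_mem, realize_eql,
    Fin.snoc_last, Fin.snoc_castSucc]
  intro x y h
  ext z
  exact ⟨fun hz => (h ⟨z, x.mem_of_mem hz⟩).1 hz, fun hz => (h ⟨z, y.mem_of_mem hz⟩).2 hz⟩

theorem level_models_foundation : Level o ⊨ foundation := by
  simp only [foundation, Sentence.Realize, Formula.Realize, realize_all, realize_isEmpty,
    BoundedFormula.realize_imp, BoundedFormula.realize_not, realize_exIn, realize_allIn,
    realize_mem, Fin.snoc_last, Fin.snoc_castSucc]
  intro c hc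
  obtain ⟨x, hx, h⟩ := ZFSet.regularity c.1 hc
  refine ⟨⟨x, c.mem_of_mem hx⟩, hx, fun y hy hyc => ?_⟩
  exact ZFSet.notMem_empty y.1 (h ▸ ZFSet.mem_inter.2 ⟨hyc, hy⟩)

theorem level_models_union : Level (κ.ord + 1) ⊨ union := by
  simp only [union, Sentence.Realize, Formula.Realize, realize_allSet, realize_exSet, realize_all,
    BoundedFormula.realize_iff, realize_exIn, realize_mem, Fin.snoc_last, Fin.snoc_castSucc]
  intro x hx
  have := sUnion_mem_level hx
  refine ⟨⟨_, mem_level_add_one_of_mem this⟩, this, fun z => ?_⟩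
  rw [ZFSet.mem_sUnion]
  exact (Level.exists_mem (P := fun y => z.1 ∈ y)).symm

theorem level_models_comprehension {n : ℕ} (φ : Fm (n + 1)) :
    Level (o + 1) ⊨ comprehension φ := by
  rw [comprehension, Sentence.Realize, BoundedFormula.realize_alls]
  simp only [realize_ex, realize_allSet, BoundedFormula.realize_iff, realize_mem, Fin.snoc_last,
    Fin.snoc_castSucc]
  intro xs
  let c : ZFSet.{u} := (ZFSet.vonNeumann o).sep fun x => ∃ h : x ∈ ZFSet.vonNeumann (o + 1),
    (relativize φ).Realize default (Fin.snoc xs (⟨x, h⟩ : Level (o + 1)))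
  refine ⟨⟨c, mem_level_add_one.2 ZFSet.sep_subset⟩, fun x hx => ?_⟩
  rw [BoundedFormula.realize_liftAt_one (Nat.le_succ n)]
  -- The lift skips index `n`, occupied by the class `c`: parameters keep their indices and the
  -- variable for `x` moves to `n + 1`.
  have : (Fin.snoc (Fin.snoc xs (⟨c, mem_level_add_one.2 ZFSet.sep_subset⟩ : Level (o + 1))) x :
      Fin (n + 1 + 1) → Level (o + 1)) ∘ (fun i : Fin (n + 1) =>
        if (i : ℕ) < n then Fin.castSucc i else i.succ) = Fin.snoc xs x := by
    funext i
    refine Fin.lastCases ?_ (fun i => ?_) i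
    · simp only [Function.comp_apply, Fin.val_last, lt_irrefl, if_false, Fin.snoc_last,
        Fin.succ_last]
    · simp only [Function.comp_apply, Fin.val_castSucc, i.2, if_true, Fin.snoc_castSucc]
      exact Fin.snoc_castSucc (α := fun _ => Level (o + 1)) _ _ _
  rw [this, ZFSet.mem_sep]
  exact ⟨fun h => h.2.2, fun h => ⟨hx, x.2, h⟩⟩

variable (hκ : IsInaccessible κ)

include hκ

theorem level_models_pairing : Level (κ.ord + 1) ⊨ pairing := by
  simp only [pairing, Sentence.Realize, Formula.Realize, realize_allSet, realize_exSet,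
    realize_isUPair, Fin.snoc_last, Fin.snoc_castSucc]
  intro x hx y hy
  have := upair_mem_level hκ hx hy
  exact ⟨⟨_, mem_level_add_one_of_mem this⟩, this, rfl⟩

theorem level_models_powerset : Level (κ.ord + 1) ⊨ powerset := by
  simp only [powerset, Sentence.Realize, Formula.Realize, realize_allSet, realize_exSet,
    realize_all, BoundedFormula.realize_iff, realize_sub, realize_mem, Fin.snoc_last,
    Fin.snoc_castSucc]
  intro x hx
  have := powerset_mem_level hκ hx
  exact ⟨⟨_, mem_level_add_one_of_mem this⟩, this, fun z => ZFSet.mem_powerset⟩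

theorem level_models_infinity : Level (κ.ord + 1) ⊨ infinity := by
  simp only [infinity, Sentence.Realize, Formula.Realize, realize_exSet, realize_conj,
    realize_exIn, realize_allIn, realize_isEmpty, realize_all, BoundedFormula.realize_iff,
    realize_disj, realize_eql, realize_mem, Fin.snoc_last, Fin.snoc_castSucc]
  have hω : Ordinal.omega0.toZFSet ∈ ZFSet.vonNeumann κ.ord := by
    rw [ZFSet.mem_vonNeumann, Ordinal.rank_toZFSet, ← ord_aleph0, ord_lt_ord]
    exact hκ.1
  let w : Level (κ.ord + 1) := ⟨_, mem_level_add_one_of_mem hω⟩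
  have hw : w.1 = Ordinal.omega0.toZFSet := rfl
  refine ⟨w, hω, ?_, fun x hx => ?_⟩
  · have h0 : (∅ : ZFSet) ∈ w.1 := by
      rw [hw, ← Ordinal.toZFSet_zero, Ordinal.toZFSet_mem_toZFSet_iff]
      exact Ordinal.omega0_pos
    exact ⟨⟨∅, w.mem_of_mem h0⟩, h0, rfl⟩
  · rw [hw, Ordinal.mem_toZFSet_iff] at hx
    obtain ⟨a, ha, hax⟩ := hx
    have h1 : (a + 1).toZFSet ∈ w.1 := by
      rw [hw, Ordinal.toZFSet_mem_toZFSet_iff]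
      exact Ordinal.isSuccLimit_omega0.add_one_lt ha
    refine ⟨⟨_, w.mem_of_mem h1⟩, h1, fun z => ?_⟩
    show z.1 ∈ (a + 1).toZFSet ↔ _
    rw [Ordinal.toZFSet_add_one, hax, ZFSet.mem_insert_iff, or_comm]

theorem level_models_replacement : Level (κ.ord + 1) ⊨ replacement := by
  classical
  simp only [replacement, Sentence.Realize, Formula.Realize, realize_all, realize_allSet,
    realize_exSet, realize_exIn, realize_pairMem, realize_eql, realize_conj,
    BoundedFormula.realize_imp, BoundedFormula.realize_iff, realize_mem, Fin.snoc_last,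
    Fin.snoc_castSucc]
  intro f hf a ha
  let b : ZFSet.{u} := (ZFSet.vonNeumann κ.ord).sep fun y => ∃ x ∈ a.1, ZFSet.pair x y ∈ f.1
  have hb : b ∈ ZFSet.vonNeumann κ.ord := by
    refine mem_level_of_card_lt hκ ZFSet.sep_subset (lt_of_le_of_lt ?_ (card_lt_of_mem_level hκ ha))
    have hex : ∀ y : b, ∃ x : a.1, ZFSet.pair x.1 y.1 ∈ f.1 := fun y => by
      obtain ⟨x, hx, h⟩ := (ZFSet.mem_sep.1 y.2).2
      exact ⟨⟨x, hx⟩, h⟩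
    choose g hg using hex
    have hinj : Function.Injective g := fun y z hyz => by
      refine Subtype.ext (hf ⟨_, Level.fst_mem (hg y) f.2⟩ ⟨_, Level.snd_mem (hg y) f.2⟩
        ⟨_, Level.snd_mem (hg z) f.2⟩ ⟨hg y, ?_⟩)
      show ZFSet.pair (g y).1 z.1 ∈ f.1
      rw [hyz]
      exact hg z
    rw [← Cardinal.lift_le.{u + 1}, ← ZFSet.cardinalMk_coe_sort, ← ZFSet.cardinalMk_coe_sort]
    exact mk_le_of_injective hinj
  refine ⟨⟨b, mem_level_add_one_of_mem hb⟩, hb, fun y => ?_⟩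
  rw [ZFSet.mem_sep, ← Level.exists_mem (P := fun x => ZFSet.pair x y.1 ∈ f.1)]
  refine and_iff_right_of_imp ?_
  rintro ⟨x, hx, hxy⟩
  have hp := mem_level_add_one.1 f.2 hxy
  exact (Level.components_mem hp).2

theorem level_models_choice : Level (κ.ord + 1) ⊨ choice := by
  classical
  simp only [choice, Sentence.Realize, Formula.Realize, realize_all, realize_allSet,
    realize_exSet, realize_allIn, realize_isEmpty, BoundedFormula.realize_not, realize_ex,
    realize_pairMem, realize_isFun, realize_conj, BoundedFormula.realize_imp, realize_mem,
    Fin.snoc_last, Fin.snoc_castSucc]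
  intro a ha hne
  have h1 : ∀ x ∈ a.1, ∃ y, y ∈ x := fun x hx => by
    have := hne ⟨x, a.mem_of_mem hx⟩ hx
    obtain h | h := ZFSet.eq_empty_or_nonempty x
    · exact absurd h this
    · exact h
  choose! c hc using h1
  let b : ZFSet.{u} := ZFSet.sUnion a.1
  have hb : b ∈ ZFSet.vonNeumann κ.ord := sUnion_mem_level ha
  let f : ZFSet.{u} := (ZFSet.prod a.1 b).sep fun p => ∃ x, p = ZFSet.pair x (c x)
  have hf : f ∈ ZFSet.vonNeumann κ.ord :=
    ZFSet.mem_vonNeumann_of_subset ZFSet.sep_subset (prod_mem_level hκ ha hb)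
  have hmem : ∀ x y, ZFSet.pair x y ∈ f ↔ x ∈ a.1 ∧ y = c x := by
    intro x y
    simp only [f, ZFSet.mem_sep, ZFSet.pair_mem_prod, ZFSet.pair_inj]
    constructor
    · rintro ⟨h, x, rfl, rfl⟩
      exact ⟨h.1, rfl⟩
    · rintro ⟨h, rfl⟩
      exact ⟨⟨h, ZFSet.mem_sUnion.2 ⟨x, h, hc x h⟩⟩, x, rfl, rfl⟩
  refine ⟨⟨f, mem_level_add_one_of_mem hf⟩, hf, ⟨b, mem_level_add_one_of_mem hb⟩,
    ⟨ZFSet.sep_subset (p := fun p => ∃ x, p = ZFSet.pair x (c x)),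
      fun x hx => ⟨c x, (hmem _ _).2 ⟨hx, rfl⟩, fun y hy => ((hmem _ _).1 hy).2⟩⟩,
    fun x y hxy => ?_⟩
  obtain ⟨hx, hy⟩ := (hmem _ _).1 hxy
  rw [hy]
  exact hc _ hx

theorem level_models_GBAC : Level (κ.ord + 1) ⊨ GBAC := by
  rw [Theory.model_iff]
  rintro φ ((rfl | rfl | rfl | rfl | rfl | rfl | rfl | rfl) | ⟨n, φ, rfl⟩)
  · exact level_models_extensionality
  · exact level_models_foundation
  · exact level_models_pairing hκ
  · exact level_models_union
  · exact level_models_powerset hκ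
  · exact level_models_infinity hκ
  · exact level_models_replacement hκ
  · exact level_models_choice hκ
  · exact level_models_comprehension φ

end Axioms

/-! ## Graphs in a level and graphs on types -/

section Bridge

theorem exists_fun_of_isFunc {x y f : ZFSet.{u}} (h : ZFSet.IsFunc x y f) :
    ∃ F : x → y, ∀ a b, ZFSet.pair a b ∈ f ↔ ∃ ha : a ∈ x, b = (F ⟨a, ha⟩).1 := by
  have h1 : ∀ a : x, ∃ b : y, ZFSet.pair a.1 b.1 ∈ f := fun a => by
    obtain ⟨b, hb, -⟩ := h.2 a.1 a.2
    exact ⟨⟨b, (ZFSet.pair_mem_prod.1 (h.1 hb)).2⟩, hb⟩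
  choose F hF using h1
  refine ⟨F, fun a b => ⟨fun hab => ?_, ?_⟩⟩
  · have ha := (ZFSet.pair_mem_prod.1 (h.1 hab)).1
    exact ⟨ha, (h.2 a ha).unique hab (hF ⟨a, ha⟩)⟩
  · rintro ⟨ha, rfl⟩
    exact hF ⟨a, ha⟩

theorem exists_isFunc_of_fun {x y : ZFSet.{u}} (F : x → y) :
    ∃ f, ZFSet.IsFunc x y f ∧ ∀ a b, ZFSet.pair a b ∈ f ↔ ∃ ha : a ∈ x, b = (F ⟨a, ha⟩).1 := by
  let f := (ZFSet.prod x y).sep fun p => ∃ a : x, p = ZFSet.pair a.1 (F a).1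
  have hf : ∀ a b, ZFSet.pair a b ∈ f ↔ ∃ ha : a ∈ x, b = (F ⟨a, ha⟩).1 := by
    intro a b
    simp only [f, ZFSet.mem_sep, ZFSet.pair_mem_prod, ZFSet.pair_inj]
    constructor
    · rintro ⟨-, a, rfl, rfl⟩
      exact ⟨a.2, rfl⟩
    · rintro ⟨ha, rfl⟩
      exact ⟨⟨ha, (F _).2⟩, ⟨a, ha⟩, rfl, rfl⟩
  refine ⟨f, ⟨ZFSet.sep_subset, fun a ha => ⟨(F ⟨a, ha⟩).1, (hf _ _).2 ⟨ha, rfl⟩, fun b hb => ?_⟩⟩,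
    hf⟩
  exact ((hf _ _).1 hb).2

variable {α β : Type u} {x y e d : ZFSet.{u}}

/-- The relation that the edge set `e` induces on an enumeration of the vertex set. -/
def edgeRel (i : α ≃ x) (e : ZFSet.{u}) (a b : α) : Prop := ZFSet.pair (i a).1 (i b).1 ∈ e

theorem IsGraphHom.exists_relHom {h : ZFSet.{u}} (hh : IsGraphHom h x e y d) (i : α ≃ x)
    (j : β ≃ y) : ∃ F : edgeRel i e →r edgeRel j d,
      ∀ a b, ZFSet.pair (i a).1 (j b).1 ∈ h ↔ b = F a := by
  obtain ⟨F, hF⟩ := exists_fun_of_isFunc hh.1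
  refine ⟨⟨fun a => j.symm (F (i a)), fun {a b} hab => ?_⟩, fun a b => ?_⟩
  · obtain ⟨a', b', ha, hb, hab'⟩ := hh.2 _ _ hab
    obtain ⟨_, rfl⟩ := (hF _ _).1 ha
    obtain ⟨_, rfl⟩ := (hF _ _).1 hb
    simpa [edgeRel] using hab'
  · show _ ↔ b = j.symm (F (i a))
    rw [hF, Equiv.eq_symm_apply, Subtype.ext_iff]
    exact ⟨fun h => h.2, fun h => ⟨(i a).2, h⟩⟩

theorem exists_isGraphHom (i : α ≃ x) (j : β ≃ y) (he : e ⊆ ZFSet.prod x x)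
    (F : edgeRel i e →r edgeRel j d) : ∃ h, IsGraphHom h x e y d := by
  obtain ⟨h, hh, hF⟩ := exists_isFunc_of_fun fun a => j (F (i.symm a))
  refine ⟨h, hh, fun a b hab => ?_⟩
  obtain ⟨ha, hb⟩ := ZFSet.pair_mem_prod.1 (he hab)
  refine ⟨_, _, (hF _ _).2 ⟨ha, rfl⟩, (hF _ _).2 ⟨hb, rfl⟩, F.map_rel ?_⟩
  simpa [edgeRel] using hab

end Bridge

/-! ### SWVP and VP in a level -/

variable {κ : Cardinal.{u}}

theorem toZFSet_mem_level {o a : Ordinal.{u}} : a.toZFSet ∈ ZFSet.vonNeumann o ↔ a < o := by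
  rw [ZFSet.mem_vonNeumann, Ordinal.rank_toZFSet]

theorem IsGraphHom.mem_level (hκ : IsInaccessible κ) {h x e y d : ZFSet.{u}}
    (hh : IsGraphHom h x e y d) (hx : x ∈ ZFSet.vonNeumann κ.ord)
    (hy : y ∈ ZFSet.vonNeumann κ.ord) : h ∈ ZFSet.vonNeumann κ.ord :=
  ZFSet.mem_vonNeumann_of_subset hh.1.1 (prod_mem_level hκ hx hy)

theorem IsGraphOn.eq_and_eq {g x e y d : ZFSet.{u}} (h : IsGraphOn g x e) (h' : IsGraphOn g y d) :
    x = y ∧ e = d :=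
  ZFSet.pair_inj.1 (h.1.symm.trans h'.1)

theorem level_models_SWVP (hκ : IsInaccessible κ) (h : SemiWeakVopenka κ) :
    Level (κ.ord + 1) ⊨ SWVP := by
  simp only [SWVP, Sentence.Realize, Formula.Realize, BoundedFormula.realize_not, realize_ex,
    realize_conj, realize_all, BoundedFormula.realize_imp, realize_isOrdSeq, realize_pairMem,
    realize_disj, realize_mem, realize_eql, realize_existsHom, Fin.snoc_last, Fin.snoc_castSucc]
  rintro ⟨s, ⟨hs1, hs2⟩, hdown, hup⟩
  let c : κ.ord.ToType → ZFSet.{u} := fun a => (Ordinal.ToType.mk.symm a).1.toZFSet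
  have hc : ∀ a, c a ∈ ZFSet.vonNeumann κ.ord := fun a =>
    toZFSet_mem_level.2 (Ordinal.ToType.mk.symm a).2
  have hclt : ∀ {a b}, c a ∈ c b ↔ a < b := fun {a b} => by
    rw [Ordinal.toZFSet_mem_toZFSet_iff, Subtype.coe_lt_coe, OrderIso.lt_iff_lt]
  have h1 : ∀ a, ∃ g x e, ZFSet.pair (c a) g ∈ s.1 ∧ IsGraphOn g x e := fun a => by
    obtain ⟨g, hg, -⟩ := hs2 (c a) (hc a) (ZFSet.isOrdinal_toZFSet _)
    obtain ⟨a', g', -, -, ⟨x, e, h'⟩, heq⟩ := hs1 _ hg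
    exact ⟨g, x, e, hg, (ZFSet.pair_inj.1 heq).2 ▸ h'⟩
  choose g x e hg hgr using h1
  have hx : ∀ a, x a ∈ ZFSet.vonNeumann κ.ord := fun a => by
    have := Level.components_mem (mem_level_add_one.1 s.2 (hg a))
    exact (Level.components_mem ((hgr a).1 ▸ this.2)).1
  let i : ∀ a, Shrink.{u} (x a) ≃ x a := fun a => (equivShrink _).symm
  let c' : κ.ord.ToType → Level (κ.ord + 1) := fun a => ⟨c a, Level.fst_mem (hg a) s.2⟩
  let g' : κ.ord.ToType → Level (κ.ord + 1) := fun a => ⟨g a, Level.snd_mem (hg a) s.2⟩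
  obtain ⟨a, b, hab, ⟨F⟩⟩ := h (fun a => Shrink.{u} (x a)) (fun a => edgeRel (i a) (e a))
    (fun a => card_lt_of_mem_level hκ (hx a)) (fun a b hab => by
      obtain ⟨k, x₁, e₁, x₂, e₂, h₁, h₂, hk⟩ := hdown (c' a) (c' b) (g' a) (g' b)
        ⟨hg a, hg b, hab.lt_or_eq.imp hclt.2 fun h => congrArg c h⟩
      obtain ⟨rfl, rfl⟩ := h₁.eq_and_eq (hgr b)
      obtain ⟨rfl, rfl⟩ := h₂.eq_and_eq (hgr a)
      exact ⟨(hk.exists_relHom (i b) (i a)).choose⟩)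
  obtain ⟨k, hk⟩ := exists_isGraphHom (i a) (i b) (hgr a).2 F
  have hkV := mem_level_add_one_of_mem (hk.mem_level hκ (hx a) (hx b))
  exact hup (c' a) (c' b) (g' a) (g' b) ⟨hg a, hg b, hclt.2 hab⟩
    ⟨⟨k, hkV⟩, _, _, _, _, hgr a, hgr b, hk⟩

theorem exists_graph_of_rel {G : Type u} (R : G → G → Prop)
    (hG : #G < κ) : ∃ x e : ZFSet.{u}, ∃ i : G ≃ x, x ∈ ZFSet.vonNeumann κ.ord ∧ e ⊆ ZFSet.prod x x ∧
      edgeRel i e = R := by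
  let x := (#G).ord.toZFSet
  have hx : x ∈ ZFSet.vonNeumann κ.ord := toZFSet_mem_level.2 (ord_lt_ord.2 hG)
  have hc : x.card = #G := by rw [Ordinal.card_toZFSet, card_ord]
  let i : G ≃ x := (Cardinal.eq.1 hc).some.symm.trans (equivShrink x).symm
  refine ⟨x, (ZFSet.prod x x).sep fun p => ∃ v w, R v w ∧ p = ZFSet.pair (i v).1 (i w).1, i, hx,
    ZFSet.sep_subset, ?_⟩
  ext v w
  simp only [edgeRel, ZFSet.mem_sep, ZFSet.pair_mem_prod, ZFSet.pair_inj, Subtype.coe_inj,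
    EmbeddingLike.apply_eq_iff_eq]
  constructor
  · rintro ⟨-, v', w', h, rfl, rfl⟩
    exact h
  · exact fun h => ⟨⟨(i v).2, (i w).2⟩, v, w, h, rfl, rfl⟩

/-- Rigidity also makes the coded graphs pairwise distinct, so their class has `κ` elements and is
not a set of the level. -/
theorem level_not_models_VP (hκ : IsInaccessible κ)
    (hmin : ∀ c < κ, IsInaccessible c → ¬ SemiWeakVopenka c) : ¬ Level (κ.ord + 1) ⊨ VP := by
  obtain ⟨G, R, hG, hrigid⟩ := exists_rigid_family hκ hmin
  choose x e i hx he hR using fun a => exists_graph_of_rel (R a) (hG a)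
  simp only [VP, Sentence.Realize, Formula.Realize, BoundedFormula.realize_not, realize_all,
    realize_conj, realize_allIn, realize_exIn, realize_ex, BoundedFormula.realize_imp,
    realize_isSet, realize_isGraph, realize_isHom, realize_pairMem, realize_eql,
    Fin.snoc_last, Fin.snoc_castSucc]
  intro hVP
  have hgV : ∀ a, ZFSet.pair (x a) (e a) ∈ ZFSet.vonNeumann κ.ord := fun a =>
    pair_mem_level hκ (hx a) (ZFSet.mem_vonNeumann_of_subset (he a)
      (prod_mem_level hκ (hx a) (hx a)))
  have key : ∀ a b h, IsGraphHom h (x a) (e a) (x b) (e b) →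
      a = b ∧ ∀ v w, ZFSet.pair v w ∈ h → v = w := by
    intro a b h hh
    obtain ⟨F, hF⟩ := hh.exists_relHom (i a) (i b)
    obtain ⟨rfl, hFv⟩ := hrigid a b ⟨F, fun {v w} hvw => hR b ▸ F.map_rel ((hR a).symm ▸ hvw)⟩
    refine ⟨rfl, fun v w hvw => ?_⟩
    obtain ⟨hv, hw⟩ := ZFSet.pair_mem_prod.1 (hh.1.1 hvw)
    obtain ⟨v', hv'⟩ := (i a).surjective ⟨v, hv⟩
    obtain ⟨w', hw'⟩ := (i a).surjective ⟨w, hw⟩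
    obtain rfl : w' = v' := ((hF v' w').1 (by rwa [hv', hw'])).trans (eq_of_heq (hFv v'))
    exact congrArg Subtype.val (hv'.symm.trans hw')
  have hinj : ∀ a b, ZFSet.pair (x a) (e a) = ZFSet.pair (x b) (e b) → a = b := by
    intro a b hab
    obtain ⟨k, hk⟩ := exists_isGraphHom (i a) (i a) (he a) (RelHom.id _)
    obtain ⟨h1, h2⟩ := ZFSet.pair_inj.1 hab
    exact (key a b k (by rwa [← h1, ← h2])).1
  let C : ZFSet.{u} := (ZFSet.vonNeumann κ.ord).sep fun p => ∃ a, p = ZFSet.pair (x a) (e a)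
  have hC : ∀ {p}, p ∈ C ↔ ∃ a, p = ZFSet.pair (x a) (e a) := fun {p} =>
    ⟨fun h => (ZFSet.mem_sep.1 h).2, fun ⟨a, h⟩ => ZFSet.mem_sep.2 ⟨h ▸ hgV a, a, h⟩⟩
  have hCV : C ∉ ZFSet.vonNeumann κ.ord := fun hCV => by
    refine absurd (card_lt_of_mem_level hκ hCV) (not_lt.2 ?_)
    let f : κ.ord.ToType → Shrink.{u} C := fun a =>
      equivShrink C ⟨ZFSet.pair (x a) (e a), hC.2 ⟨a, rfl⟩⟩
    have hf : Function.Injective f := fun a b hab =>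
      hinj a b (congrArg Subtype.val ((equivShrink C).injective hab))
    have := mk_le_of_injective hf
    rwa [mk_ord_toType] at this
  obtain ⟨g, hg, g', hg', h, ⟨x₁, e₁, x₂, e₂, h₁, h₂, hh⟩, hne⟩ :=
    hVP ⟨C, mem_level_add_one.2 ZFSet.sep_subset⟩ ⟨hCV, fun g hg => by
      obtain ⟨a, ha⟩ := hC.1 hg
      exact ⟨_, _, ha, he a⟩⟩
  obtain ⟨a, ha⟩ := hC.1 hg
  obtain ⟨b, hb⟩ := hC.1 hg'
  obtain ⟨rfl, rfl⟩ := h₁.eq_and_eq ⟨ha, he a⟩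
  obtain ⟨rfl, rfl⟩ := h₂.eq_and_eq ⟨hb, he b⟩
  obtain ⟨rfl, hid⟩ := key a b h.1 hh
  exact hne ⟨ha.trans hb.symm, fun v w hvw => hid v.1 w.1 hvw⟩

/-! ## Supercompact cardinals of a level -/

section RealizeSupercompact

variable {n : ℕ} {o : Ordinal.{u}} {v : Empty → Level o} {xs : Fin n → Level o}

theorem Level.eq_sep {r p : Level o} {P : ZFSet.{u} → Prop}
    (h : ∀ z : Level o, z.1 ∈ r.1 ↔ z.1 ∈ p.1 ∧ P z.1) : r.1 = p.1.sep P := by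
  ext z
  rw [ZFSet.mem_sep]
  exact ⟨fun hz => (h ⟨z, r.mem_of_mem hz⟩).1 hz, fun hz => (h ⟨z, p.mem_of_mem hz.1⟩).2 hz⟩

@[simp] theorem realize_cardLT {a k : Fin n} :
    (cardLT a k).Realize v xs ↔
      ∃ b ∈ (xs k).1, ∃ f : Level o, IsInjFunc (xs a).1 b f.1 := by
  simp only [cardLT, realize_exIn, realize_ex, realize_isInj, Fin.snoc_last, Fin.snoc_castSucc]
  exact Level.exists_mem (P := fun b => ∃ f : Level o, IsInjFunc (xs a).1 b f.1)

/-- `u` is an ultrafilter on `p`. -/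
structure IsUltrafilterOn (u p : ZFSet.{u}) : Prop where
  subset : ∀ s ∈ u, s ⊆ p
  univ_mem : p ∈ u
  ne_empty : ∀ s ∈ u, s ≠ ∅
  mem_of_superset : ∀ s ∈ u, ∀ t, s ⊆ t → t ⊆ p → t ∈ u
  inter_mem : ∀ s ∈ u, ∀ t ∈ u, (s.sep (· ∈ t)) ∈ u
  mem_or_compl_mem : ∀ s ⊆ p, s ∈ u ∨ (p.sep (· ∉ s)) ∈ u

theorem isUltrafilterOn_of_realize {u p : Fin n} (h : (isUltrafilter u p).Realize v xs) :
    IsUltrafilterOn (xs u).1 (xs p).1 := by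
  simp only [isUltrafilter, realize_conj, realize_allIn, realize_sub, realize_mem,
    BoundedFormula.realize_not, realize_isEmpty, realize_all, BoundedFormula.realize_imp,
    realize_exIn, BoundedFormula.realize_iff, realize_disj, Fin.snoc_last,
    Fin.snoc_castSucc] at h
  obtain ⟨h1, h2, h3, h4, h5, h6⟩ := h
  have hsub : ∀ {t}, t ⊆ (xs p).1 → t ∈ ZFSet.vonNeumann o := fun ht =>
    ZFSet.mem_vonNeumann_of_subset ht (xs p).2
  refine ⟨fun s hs => h1 ⟨s, (xs u).mem_of_mem hs⟩ hs, h2,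
    fun s hs => h3 ⟨s, (xs u).mem_of_mem hs⟩ hs,
    fun s hs t hst htp => h4 ⟨s, (xs u).mem_of_mem hs⟩ hs ⟨t, hsub htp⟩ ⟨hst, htp⟩,
    fun s hs t ht => ?_, fun s hs => ?_⟩
  · obtain ⟨r, hr, h⟩ := h5 ⟨s, (xs u).mem_of_mem hs⟩ hs ⟨t, (xs u).mem_of_mem ht⟩ ht
    rwa [← Level.eq_sep (p := ⟨s, (xs u).mem_of_mem hs⟩) (P := (· ∈ t)) h]
  · refine (h6 ⟨s, hsub hs⟩ hs).imp_right ?_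
    rintro ⟨r, hr, h⟩
    rwa [← Level.eq_sep (P := (· ∉ s)) h]

theorem sep_mem_of_realize_isFine {u p x : Fin n} (h : (isFine u p x).Realize v xs)
    {y : ZFSet.{u}} (hy : y ∈ (xs x).1) : ((xs p).1.sep (y ∈ ·)) ∈ (xs u).1 := by
  simp only [isFine, realize_conj, realize_allIn, realize_mem, realize_all,
    realize_exIn, BoundedFormula.realize_iff, Fin.snoc_last, Fin.snoc_castSucc] at h
  obtain ⟨r, hr, h⟩ := h ⟨y, (xs x).mem_of_mem hy⟩ hy
  rwa [← Level.eq_sep (P := (y ∈ ·)) h]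

theorem exists_of_realize_isNormal {u x : Fin n} (h : (isNormal u x).Realize v xs)
    {s f : ZFSet.{u}} (hs : s ∈ (xs u).1) (hfo : f ∈ ZFSet.vonNeumann o)
    (hf : ZFSet.IsFunc s (xs x).1 f) (hmem : ∀ a y, ZFSet.pair a y ∈ f → y ∈ a) :
    ∃ y ∈ (xs x).1, ∃ t ∈ (xs u).1, t ⊆ s ∧ ∀ a ∈ t, ZFSet.pair a y ∈ f := by
  simp only [isNormal, realize_conj, realize_allIn, realize_mem, realize_all, realize_isFun,
    realize_pairMem, realize_sub, BoundedFormula.realize_imp, realize_exIn, Fin.snoc_last,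
    Fin.snoc_castSucc] at h
  obtain ⟨y, hy, t, ht, hts, h⟩ := h ⟨s, (xs u).mem_of_mem hs⟩ hs ⟨f, hfo⟩
    ⟨hf, fun a y => hmem a.1 y.1⟩
  exact ⟨y.1, hy, t.1, ht, hts, fun a ha => h ⟨a, t.mem_of_mem ha⟩ ha⟩

theorem sep_mem_of_realize_isComplete {v : Empty → Level (o + 1)} {xs : Fin n → Level (o + 1)}
    {u p k : Fin n} (h : (isComplete u p k).Realize v xs) {c : ZFSet.{u}}
    (hc : c ∈ ZFSet.vonNeumann o) (hcu : c ⊆ (xs u).1)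
    (hck : ∃ b ∈ (xs k).1, ∃ f : Level (o + 1), IsInjFunc c b f.1) :
    ((xs p).1.sep fun a => ∀ t ∈ c, a ∈ t) ∈ (xs u).1 := by
  simp only [isComplete, realize_conj, realize_allIn, realize_mem, realize_all, realize_allSet,
    realize_sub, realize_cardLT, BoundedFormula.realize_imp, BoundedFormula.realize_iff,
    realize_exIn, Fin.snoc_last, Fin.snoc_castSucc] at h
  let c' : Level (o + 1) := ⟨c, ZFSet.vonNeumann_subset_of_le (by simp) hc⟩
  obtain ⟨r, hr, h⟩ := h c' hc ⟨hcu, hck⟩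
  rwa [← Level.eq_sep (P := fun a => ∀ t ∈ c, a ∈ t) fun z => (h z).trans
    (and_congr_right fun _ => Level.forall_mem (x := c') (P := fun t => z.1 ∈ t))]

end RealizeSupercompact

theorem IsInjFunc.card_le {x y f : ZFSet.{u}} (h : IsInjFunc x y f) : x.card ≤ y.card := by
  obtain ⟨F, hF⟩ := exists_fun_of_isFunc h.1
  rw [← Cardinal.lift_le.{u + 1}, ← ZFSet.cardinalMk_coe_sort, ← ZFSet.cardinalMk_coe_sort]
  refine mk_le_of_injective (f := F) fun a b hab => Subtype.ext ?_
  exact h.2 a.1 b.1 (F a).1 ((hF _ _).2 ⟨a.2, rfl⟩) ((hF _ _).2 ⟨b.2, congrArg _ hab⟩)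

theorem exists_isInjFunc {x y : ZFSet.{u}} (h : x.card ≤ y.card) : ∃ f, IsInjFunc x y f := by
  rw [← Cardinal.lift_le.{u + 1}, ← ZFSet.cardinalMk_coe_sort, ← ZFSet.cardinalMk_coe_sort] at h
  obtain ⟨F⟩ := h
  obtain ⟨f, hf, hF⟩ := exists_isFunc_of_fun F
  refine ⟨f, hf, fun a b c hac hbc => ?_⟩
  obtain ⟨ha, rfl⟩ := (hF _ _).1 hac
  obtain ⟨hb, h⟩ := (hF _ _).1 hbc
  exact congrArg Subtype.val (F.injective (Subtype.ext h))

/-! ### Absoluteness of cardinalities -/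

section CardLT

variable {κ μ : Cardinal.{u}} {x y : ZFSet.{u}}

theorem exists_isInjFunc_level (hκ : IsInaccessible κ) (hx : x ∈ ZFSet.vonNeumann κ.ord)
    (hy : y ∈ ZFSet.vonNeumann κ.ord) (h : x.card ≤ y.card) :
    ∃ f : Level (κ.ord + 1), IsInjFunc x y f.1 := by
  obtain ⟨f, hf⟩ := exists_isInjFunc h
  exact ⟨⟨f, mem_level_add_one_of_mem
    (ZFSet.mem_vonNeumann_of_subset hf.1.1 (prod_mem_level hκ hx hy))⟩, hf⟩

theorem level_cardLT_iff (hκ : IsInaccessible κ) (hμ : μ < κ) (hx : x ∈ ZFSet.vonNeumann κ.ord) :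
    (∃ b ∈ μ.ord.toZFSet, ∃ f : Level (κ.ord + 1), IsInjFunc x b f.1) ↔ x.card < μ := by
  constructor
  · rintro ⟨b, hb, f, hf⟩
    obtain ⟨β, hβ, rfl⟩ := Ordinal.mem_toZFSet_iff.1 hb
    refine hf.card_le.trans_lt ?_
    rwa [Ordinal.card_toZFSet, ← lt_ord]
  · intro h
    refine ⟨x.card.ord.toZFSet, Ordinal.toZFSet_mem_toZFSet_iff.2 (ord_lt_ord.2 h), ?_⟩
    refine exists_isInjFunc_level hκ hx (toZFSet_mem_level.2 (ord_lt_ord.2 (h.trans hμ))) ?_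
    rw [Ordinal.card_toZFSet, card_ord]

theorem exists_of_realize_isUncountableCard (hκ : IsInaccessible κ) {n : ℕ} {k : Fin n}
    {v : Empty → Level (κ.ord + 1)} {xs : Fin n → Level (κ.ord + 1)}
    (h : (isUncountableCard k).Realize v xs) :
    ∃ μ : Cardinal.{u}, ℵ₀ < μ ∧ μ < κ ∧ (xs k).1 = μ.ord.toZFSet := by
  simp only [isUncountableCard, isCard, realize_conj, realize_isOrd, realize_cardLT,
    BoundedFormula.realize_not, realize_exIn, realize_allIn, realize_isEmpty, realize_mem,
    Fin.snoc_last, Fin.snoc_castSucc] at h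
  obtain ⟨⟨⟨hkV, hko⟩, hk⟩, w, hwk, hw0, hw⟩ := h
  obtain ⟨α, hα⟩ := ZFSet.isOrdinal_iff_mem_range_toZFSet.1 hko
  rw [← hα] at hkV hk hwk
  have hακ : α < κ.ord := toZFSet_mem_level.1 hkV
  -- A bijection of `α` with a smaller ordinal would yield an injection in the level, where `α` is a
  -- cardinal.
  have hαc : α.card.ord = α := by
    refine (ord_card_le α).eq_of_not_lt fun hlt => hk ?_
    refine ⟨α.card.ord.toZFSet, Ordinal.toZFSet_mem_toZFSet_iff.2 hlt, ?_⟩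
    refine exists_isInjFunc_level hκ hkV (toZFSet_mem_level.2 (hlt.trans hακ)) ?_
    simp
  refine ⟨α.card, ?_, lt_ord.1 hακ, by rw [hαc, hα]⟩
  obtain ⟨β, hβ, hβw⟩ := Ordinal.mem_toZFSet_iff.1 hwk
  rw [← ord_lt_ord, hαc, ord_aleph0]
  refine lt_of_le_of_lt (Ordinal.omega0_le_of_isSuccLimit ?_) hβ
  rw [← hβw] at hw0
  refine ⟨fun h => hw0 ?_, ?_⟩
  · rw [isMin_iff_eq_bot.1 h, Ordinal.bot_eq_zero, Ordinal.toZFSet_zero]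
  · rw [Order.isSuccPrelimit_iff_succ_lt]
    intro γ hγ
    have hγw : γ.toZFSet ∈ w.1 := by
      rw [← hβw]
      exact Ordinal.toZFSet_mem_toZFSet_iff.2 hγ
    obtain ⟨y, hy, hxy⟩ := hw ⟨γ.toZFSet, w.mem_of_mem hγw⟩ hγw
    rw [← hβw] at hy
    obtain ⟨δ, hδ, hδy⟩ := Ordinal.mem_toZFSet_iff.1 hy
    rw [← hδy] at hxy
    exact (Order.succ_le_of_lt (Ordinal.toZFSet_mem_toZFSet_iff.1 hxy)).trans_lt hδ

end CardLT

/-! ### From set-coded ultrafilters to ultrafilters on types -/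

section Transfer

variable {μ : Cardinal.{u}} {Y : Type u} {x p : ZFSet.{u}}

/-- The set of those elements of `x` that are enumerated by elements of `A`. -/
def codeSet (i : Y ≃ x) (A : Set Y) : ZFSet.{u} := x.sep fun z => ∃ y ∈ A, z = (i y).1

theorem mem_codeSet (i : Y ≃ x) {A : Set Y} {y : Y} : (i y).1 ∈ codeSet i A ↔ y ∈ A := by
  simp only [codeSet, ZFSet.mem_sep, Subtype.coe_inj, EmbeddingLike.apply_eq_iff_eq]
  exact ⟨fun ⟨_, _, h, e⟩ => e ▸ h, fun h => ⟨(i y).2, y, h, rfl⟩⟩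

theorem codeSet_subset (i : Y ≃ x) (A : Set Y) : codeSet i A ⊆ x := ZFSet.sep_subset

theorem card_codeSet (i : Y ≃ x) (A : Set Y) : (codeSet i A).card = #A := by
  let f : A → Shrink.{u} (codeSet i A) := fun y =>
    equivShrink (codeSet i A) ⟨(i y).1, (mem_codeSet i).2 y.2⟩
  refine (mk_congr (Equiv.ofBijective f ⟨fun y z h => ?_, fun z => ?_⟩)).symm
  · have := Subtype.ext_iff.1 ((equivShrink (codeSet i A)).injective h)
    exact Subtype.ext (i.injective (Subtype.ext this))
  · obtain ⟨⟨z, hz⟩, rfl⟩ := (equivShrink (codeSet i A)).surjective z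
    obtain ⟨-, y, hy, rfl⟩ := ZFSet.mem_sep.1 hz
    exact ⟨⟨y, hy⟩, rfl⟩

theorem codeSet_preimage (i : Y ≃ x) {a : ZFSet.{u}} (ha : a ⊆ x) :
    codeSet i {y | (i y).1 ∈ a} = a := by
  ext z
  constructor
  · intro h
    obtain ⟨-, y, hy, rfl⟩ := ZFSet.mem_sep.1 h
    exact hy
  · intro h
    refine ZFSet.mem_sep.2 ⟨ha h, i.symm ⟨z, ha h⟩, ?_, ?_⟩ <;> simp [h]

/-- An enumeration of a set by a type induces an enumeration of its small subsets. -/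
noncomputable def smallSubsetEquiv (i : Y ≃ x) (hp : ∀ a, a ∈ p ↔ a ⊆ x ∧ a.card < μ) :
    SmallSubset μ Y ≃ p where
  toFun A := ⟨codeSet i A.1, (hp _).2 ⟨codeSet_subset i _, (card_codeSet i _).trans_lt A.2⟩⟩
  invFun a := ⟨{y | (i y).1 ∈ a.1}, by
    rw [← card_codeSet i, codeSet_preimage i ((hp _).1 a.2).1]
    exact ((hp _).1 a.2).2⟩
  left_inv A := Subtype.ext (Set.ext fun y => mem_codeSet i)
  right_inv a := Subtype.ext (codeSet_preimage i ((hp _).1 a.2).1)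

theorem isSupercompactFor_of_isUltrafilterOn {u : ZFSet.{u}} (i : Y ≃ x)
    (hp : ∀ a, a ∈ p ↔ a ⊆ x ∧ a.card < μ) (hu : IsUltrafilterOn u p)
    (hcomplete : ∀ c ⊆ u, c.card < μ → (p.sep fun a => ∀ t ∈ c, a ∈ t) ∈ u)
    (hfine : ∀ y ∈ x, (p.sep (y ∈ ·)) ∈ u)
    (hnormal : ∀ s ∈ u, ∀ f, ZFSet.IsFunc s x f → (∀ a y, ZFSet.pair a y ∈ f → y ∈ a) →
      ∃ y ∈ x, ∃ t ∈ u, t ⊆ s ∧ ∀ a ∈ t, ZFSet.pair a y ∈ f) :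
    IsSupercompactFor μ Y := by
  let j := smallSubsetEquiv i hp
  have hj : ∀ {A : SmallSubset μ Y} {y}, (i y).1 ∈ (j A).1 ↔ y ∈ A.1 := mem_codeSet i
  let c : Set (SmallSubset μ Y) → ZFSet.{u} := codeSet j
  have hc : ∀ {S A}, (j A).1 ∈ c S ↔ A ∈ S := mem_codeSet j
  have hcp : ∀ S, c S ⊆ p := codeSet_subset j
  have hcs : ∀ {t}, t ⊆ p → t = c {A | (j A).1 ∈ t} := fun ht => (codeSet_preimage j ht).symm
  have hmono : ∀ {S T}, S ⊆ T → c S ⊆ c T := fun {S T} h z hz => by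
    obtain ⟨hz, A, hA, rfl⟩ := ZFSet.mem_sep.1 hz
    exact hc.2 (h hA)
  have huc : ∀ {t}, t ∈ u → c {A | (j A).1 ∈ t} ∈ u := fun ht => hcs (hu.subset _ ht) ▸ ht
  have hsup : ∀ {S t}, t ∈ u → (∀ A, (j A).1 ∈ t → A ∈ S) → c S ∈ u := fun ht h =>
    hu.mem_of_superset _ (huc ht) _ (hmono h) (hcp _)
  let F : Filter (SmallSubset μ Y) :=
    { sets := {S | c S ∈ u}
      univ_sets := hsup hu.univ_mem fun _ _ => trivial
      sets_of_superset := fun hS hST => hu.mem_of_superset _ hS _ (hmono hST) (hcp _)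
      inter_sets := fun {S T} hS hT => hsup (hu.inter_mem _ hS _ hT) fun A hA =>
        ⟨hc.1 (ZFSet.mem_sep.1 hA).1, hc.1 (ZFSet.mem_sep.1 hA).2⟩ }
  have hF : ∀ {S}, S ∈ F ↔ c S ∈ u := Iff.rfl
  let U : Ultrafilter (SmallSubset μ Y) := Ultrafilter.ofComplNotMemIff F fun S => by
    constructor
    · intro h
      refine (hu.mem_or_compl_mem (c S) (hcp S)).resolve_right fun h' => h (hsup h' fun A hA => ?_)
      exact fun hAS => (ZFSet.mem_sep.1 hA).2 (hc.2 hAS)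
    · intro h h'
      have h0 := F.inter_sets h h'
      refine hu.ne_empty _ h0 ((ZFSet.eq_empty _).2 fun z hz => ?_)
      obtain ⟨-, A, hA, -⟩ := ZFSet.mem_sep.1 hz
      exact hA.2 hA.1
  have hU : ∀ {S}, S ∈ U ↔ c S ∈ u := Iff.rfl
  refine ⟨U, ⟨fun 𝒮 h𝒮 h => ?_⟩, fun y => ?_, fun S hS f hf => ?_⟩
  · let d : ZFSet.{u} := ZFSet.range fun S : 𝒮 => c S.1
    have hd : d ⊆ u := fun z hz => by
      obtain ⟨S, rfl⟩ := ZFSet.mem_range.1 hz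
      exact h S.1 S.2
    have hdc : d.card < μ := by
      have := ZFSet.lift_card_range_le (f := fun S : 𝒮 => c S.1)
      rw [Cardinal.lift_id, Cardinal.lift_id] at this
      exact this.trans_lt h𝒮
    refine hsup (hcomplete d hd hdc) fun A hA S hS => hc.1 ?_
    exact (ZFSet.mem_sep.1 hA).2 _ (ZFSet.mem_range.2 ⟨⟨S, hS⟩, rfl⟩)
  · exact hsup (hfine (i y) (i y).2) fun A hA => hj.1 (ZFSet.mem_sep.1 hA).2
  · have hmem : ∀ a : c S, j.symm ⟨a.1, hcp S a.2⟩ ∈ S := fun a => by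
      rw [← hc]
      simp
    let f' : c S → x := fun a => i (f ⟨_, hmem a⟩)
    obtain ⟨g, hg, hgf⟩ := exists_isFunc_of_fun f'
    obtain ⟨y, hy, t, ht, hts, h⟩ := hnormal (c S) hS g hg fun a y hay => by
      obtain ⟨ha, rfl⟩ := (hgf _ _).1 hay
      have := hj.2 (hf ⟨_, hmem ⟨a, ha⟩⟩)
      simpa using this
    refine ⟨i.symm ⟨y, hy⟩, hsup ht fun A hA => ?_⟩
    obtain ⟨ha, hya⟩ := (hgf _ _).1 (h _ hA)
    refine ⟨hc.1 ha, ?_⟩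
    rw [Equiv.eq_symm_apply]
    refine Subtype.ext (Eq.trans ?_ hya.symm)
    simp [f']

end Transfer

/-- Each size `c` below `κ` is represented by an ordinal in the level. Small subsets, subfamilies of
the ultrafilter and choice functions all belong to the level, so its ultrafilter on the small
subsets of that ordinal has the required properties outside as well. -/
theorem level_not_models_existsSupercompact {κ : Cardinal.{u}}
    (hκ : IsLeast {μ : Cardinal.{u} | IsSupercompact μ} κ) :
    ¬ Level (κ.ord + 1) ⊨ existsSupercompact := by
  have hin := IsSupercompact.isInaccessible hκ.1
  rw [existsSupercompact, Sentence.Realize, Formula.Realize, realize_ex]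
  rintro ⟨k, hk⟩
  simp only [isSupercompact, realize_conj, realize_allSet, realize_exSet] at hk
  obtain ⟨hk, h⟩ := hk
  obtain ⟨μ, hμ, hμκ, hkμ⟩ := exists_of_realize_isUncountableCard hin hk
  simp only [Fin.snoc_last] at hkμ
  refine absurd (hκ.2 (IsSupercompact.of_forall_lt hμ hμκ.le hκ.1 fun c hc => ?_)) (not_le.2 hμκ)
  have hx : c.ord.toZFSet ∈ ZFSet.vonNeumann κ.ord := toZFSet_mem_level.2 (ord_lt_ord.2 hc)
  obtain ⟨p, hpV, u, huV, hp, hu, hcomplete, hfine, hnormal⟩ :=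
    h ⟨c.ord.toZFSet, mem_level_add_one_of_mem hx⟩ hx
  refine ⟨Shrink.{u} c.ord.toZFSet, ?_, ?_⟩
  · exact (Ordinal.card_toZFSet _).trans (card_ord _)
  have hcard : ∀ a ∈ ZFSet.vonNeumann κ.ord,
      (∃ b ∈ k.1, ∃ f : Level (κ.ord + 1), IsInjFunc a b f.1) ↔ a.card < μ := fun a ha => by
    rw [hkμ]
    exact level_cardLT_iff hin hμκ ha
  simp only [isSmallSubsets, realize_all, BoundedFormula.realize_iff, realize_conj, realize_mem,
    realize_sub, realize_cardLT, Fin.snoc_last, Fin.snoc_castSucc] at hp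
  have hu' := isUltrafilterOn_of_realize hu
  simp only [Fin.snoc_last, Fin.snoc_castSucc] at hu'
  have huV' : ∀ {s}, s ∈ u.1 → s ∈ ZFSet.vonNeumann κ.ord := fun hs =>
    ZFSet.isTransitive_vonNeumann _ |>.mem_trans hs huV
  refine isSupercompactFor_of_isUltrafilterOn (p := p.1) (u := u.1) (equivShrink _).symm
    (fun a => ⟨fun ha => ?_, fun ha => ?_⟩) hu' (fun d hd hdμ => ?_) (fun y hy => ?_)
    (fun s hs f hf hmem => ?_)
  · have h1 := (hp ⟨a, p.mem_of_mem ha⟩).1 ha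
    exact ⟨h1.1, (hcard a (ZFSet.mem_vonNeumann_of_subset h1.1 hx)).1 h1.2⟩
  · have haV := ZFSet.mem_vonNeumann_of_subset ha.1 hx
    exact (hp ⟨a, mem_level_add_one_of_mem haV⟩).2 ⟨ha.1, (hcard a haV).2 ha.2⟩
  -- Completeness inside the level speaks of sets only; a subset of the set `u` is again a set of
  -- the level.
  · have hdV := ZFSet.mem_vonNeumann_of_subset hd huV
    have hdu := sep_mem_of_realize_isComplete hcomplete hdV
    simp only [Fin.snoc_last, Fin.snoc_castSucc] at hdu
    exact hdu hd ((hcard d hdV).2 hdμ)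
  · have hyu := sep_mem_of_realize_isFine hfine (y := y)
    simp only [Fin.snoc_last, Fin.snoc_castSucc] at hyu
    exact hyu hy
  · have hsu := exists_of_realize_isNormal hnormal (s := s) (f := f)
    simp only [Fin.snoc_last, Fin.snoc_castSucc] at hsu
    exact hsu hs (mem_level_add_one_of_mem
      (ZFSet.mem_vonNeumann_of_subset hf.1 (prod_mem_level hin (huV' hs) hx))) hf hmem

end SetTheoryModel

theorem mainTheorem3 (κ : Cardinal.{u})
    (hκ : IsLeast {μ : Cardinal.{u} | SetTheoryModel.IsSupercompact μ} κ) :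
    (SetTheoryModel.Level (κ.ord + 1) ⊨ SetTheoryModel.SWVP) ∧
      (SetTheoryModel.Level (κ.ord + 1) ⊨ SetTheoryModel.existsSupercompact.not) ∧
      ¬ ((SetTheoryModel.GBAC ∪ {SetTheoryModel.SWVP}) ⊨ᵇ SetTheoryModel.VP) := by
  open SetTheoryModel in
  have hin := IsSupercompact.isInaccessible hκ.1
  have hsw := IsSupercompact.semiWeakVopenka hκ.1
  refine ⟨level_models_SWVP hin hsw, ?_, fun hVP => ?_⟩
  · rw [Sentence.realize_not]
    exact level_not_models_existsSupercompact hκ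
  -- Supercompactness of `κ` serves only to make this class of cardinals nonempty; the model that
  -- separates SWVP from VP lives at its least element.
  · obtain ⟨c, ⟨hc, hcsw⟩, hmin⟩ := WellFounded.has_min (Cardinal.lt_wf)
      {c : Cardinal.{u} | Cardinal.IsInaccessible c ∧ SemiWeakVopenka c} ⟨κ, hin, hsw⟩
    have : Nonempty (Level (c.ord + 1)) :=
      ⟨⟨ZFSet.vonNeumann c.ord, ZFSet.vonNeumann_mem_of_lt (by simp)⟩⟩
    have : Level (c.ord + 1) ⊨ GBAC ∪ {SWVP} := by
      rw [Theory.model_union_iff, Theory.model_singleton_iff]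
      exact ⟨level_models_GBAC hc, level_models_SWVP hc hcsw⟩
    exact level_not_models_VP hc (fun d hd hdi hdsw => hmin d ⟨hdi, hdsw⟩ hd)
      (hVP.realize_sentence _)
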